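/- **Theorem (Semantic Soundness).** *Language.* Terms (up to renaming of bound variables) are $M,N,P ::= x \mid \mathtt{zero} \mid \mathtt{succ}(M) \mid \mathtt{pred}(M) \mid \mathtt{ifz}\,M\,N\,P \mid \lambda x.M \mid M\,N \mid \mathtt{fix}\,x.M \mid (M,N) \mid \mathtt{let}\,(x,y)=M\,\mathtt{in}\,N$, and values are $V,W ::= x \mid \underline{n} \mid (V,W) \mid \lambda x.M$, where $\underline n = \mathtt{succ}^n(\mathtt{zero})$. One-step reduction $\rhd$ is the closure of $\mathtt{ifz}\,\underline 0\,N\,P \rhd N$, $\mathtt{ifz}\,\underline{n+1}\,N\,P \rhd P$, $\mathtt{let}\,(x,y)=(V,W)\,\mathtt{in}\,M \rhd M[V/x,W/y]$, $\mathtt{fix}\,x.M \rhd M[\mathtt{fix}\,x.M/x]$, $\mathtt{pred}(\underline 0)\rhd\underline 0$, $\mathtt{pred}(\underline{n+1})\rhd\underline n$, $(\lambda x.M)\,V\rhd M[V/x]$ under the evaluation contexts $E ::= \Box \mid \mathtt{succ}(E) \mid \mathtt{pred}(E) \mid (E,M) \mid (V,E) \mid \mathtt{let}\,(x,y)=E\,\mathtt{in}\,N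 \mid \mathtt{ifz}\,E\,N\,P \mid (\lambda x.M)\,E \mid E\,N$; $\rhd^*$ is its reflexive transitive closure. A term in normal form that is not a value is *stuck*; a term *goes wrong* if it reduces to a stuck term, *diverges* if it has no normal form, and a closed term *evaluates* to $V$ if $M\rhd^* V$ with $V$ a value. *Types.* $F ::= \mathsf{Ok}\mid\mathsf{Nat}\mid F\times F$ and $A,B ::= \mathsf{Ok}\mid\mathsf{Nat}\mid A\times B\mid A\to B\mid A\rightharpoonup F$, where $A\rightharpoonup F$ is the necessity arrow ("$A$ only to $F$"). Types $A,B$ are disjoint, $A\parallel B$, if neither is $\mathsf{Ok}$ and either exactly one of them is $\mathsf{Nat}$, or exactly one is an arrow type (of either kind), or exactly one is a product. *Judgements.* $\Gamma\vdash\Delta$, with $\Gamma,\Delta$ finite sets of typings $M:A$, is provable if it is derivable with the following rules (premises $\Rightarrow$ conclusion), where the bound variables displayed in a $\lambda$, $\mathtt{fix}$ or $\mathtt{let}$ are not free in $\Gamma,\Delta$, and $i\in\{1,2\}$. - Structural: $\Gamma,x:A\vdash x:A,\Delta$; if $A\parallel B$: $\Gamma\vdash M:B,\Delta \Rightarrow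 \Gamma,M:A\vdash\Delta$. - Right: $\Gamma\vdash\mathtt{zero}:\mathsf{Nat},\Delta$; $\Gamma\vdash M:\mathsf{Nat},\Delta\Rightarrow\Gamma\vdash\mathtt{succ}(M):\mathsf{Nat},\Delta$, and likewise for $\mathtt{pred}(M)$; $\Gamma\vdash M:B\times C,\Delta$ and $\Gamma,x:B,y:C\vdash N:A,\Delta\Rightarrow\Gamma\vdash\mathtt{let}\,(x,y)=M\,\mathtt{in}\,N:A,\Delta$; $\Gamma\vdash M:B\to A,\Delta$ and $\Gamma\vdash N:B,\Delta\Rightarrow\Gamma\vdash M\,N:A,\Delta$; $\Gamma\vdash M:A,\Delta$ and $\Gamma\vdash N:B,\Delta\Rightarrow\Gamma\vdash(M,N):A\times B,\Delta$; $\Gamma,x:B\vdash M:A,\Delta\Rightarrow\Gamma\vdash\lambda x.M:B\to A,\Delta$; $\Gamma,M:F\vdash x:B,\Delta\Rightarrow\Gamma\vdash\lambda x.M:B\rightharpoonup F,\Delta$; $\Gamma,x:A\vdash M:A,\Delta\Rightarrow\Gamma\vdash\mathtt{fix}\,x.M:A,\Delta$; $\Gamma\vdash M:\mathsf{Nat},\Delta$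 and $\Gamma\vdash N:A,\Delta$ and $\Gamma\vdash P:A,\Delta\Rightarrow\Gamma\vdash\mathtt{ifz}\,M\,N\,P:A,\Delta$. - Left: $\Gamma,M:\mathsf{Nat}\vdash\Delta\Rightarrow\Gamma,\mathtt{succ}(M):\mathsf{Nat}\vdash\Delta$, and likewise for $\mathtt{pred}(M)$; $\Gamma\vdash M:B\rightharpoonup F,\Delta$ and $\Gamma,N:B\vdash\Delta\Rightarrow\Gamma,M\,N:F\vdash\Delta$; $\Gamma,M_i:A_i\vdash\Delta\Rightarrow\Gamma,(M_1,M_2):A_1\times A_2\vdash\Delta$; $\Gamma,N:A\vdash\Delta\Rightarrow\Gamma,\mathtt{let}\,(x,y)=M\,\mathtt{in}\,N:A\vdash\Delta$; $\Gamma,M:B_1\times B_2\vdash\Delta$ and, for both $i$, $\Gamma,N:A\vdash x_i:B_i,\Delta\Rightarrow\Gamma,\mathtt{let}\,(x_1,x_2)=M\,\mathtt{in}\,N:A\vdash\Delta$; $\Gamma,M:\mathsf{Nat}\vdash\Delta\Rightarrow\Gamma,\mathtt{ifz}\,M\,N\,P:A\vdash\Delta$; $\Gamma,N:A\vdash\Delta$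 and $\Gamma,P:A\vdash\Delta\Rightarrow\Gamma,\mathtt{ifz}\,M\,N\,P:A\vdash\Delta$. - $\mathsf{Ok}$: $\Gamma\vdash x:\mathsf{Ok},\Delta$; $\Gamma,M:\mathsf{Ok}\vdash\Delta\Rightarrow\Gamma,M:A\vdash\Delta$; $\Gamma\vdash M:A,\Delta\Rightarrow\Gamma\vdash M:\mathsf{Ok},\Delta$; $\Gamma,M:\mathsf{Ok}\rightharpoonup F\vdash\Delta\Rightarrow\Gamma,M\,N:\mathsf{Ok}\vdash\Delta$; $\Gamma,N:\mathsf{Ok}\vdash\Delta\Rightarrow\Gamma,M\,N:\mathsf{Ok}\vdash\Delta$; $\Gamma,M:\mathsf{Nat}\vdash\Delta\Rightarrow\Gamma,\mathtt{succ}(M):\mathsf{Ok}\vdash\Delta$, and likewise for $\mathtt{pred}(M)$; $\Gamma,M_i:\mathsf{Ok}\vdash\Delta\Rightarrow\Gamma,(M_1,M_2):\mathsf{Ok}\vdash\Delta$. *Semantics.* For a set $S$ of closed values let $\mathcal T S$ be the set of closed terms that evaluate to an element of $S$, and $\mathcal T_\bot S$ the set of closed terms that are in $\mathcal T S$ or diverge.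 Then $[\![\mathsf{Ok}]\!]$ is the set of all closed values, $[\![\mathsf{Nat}]\!]=\{\underline n\mid n\in\mathbb N\}$, $[\![A\times B]\!]=\{(V,W)\mid V\in[\![A]\!],W\in[\![B]\!]\}$, $[\![A\to B]\!]$ is the set of closed $\lambda x.M$ such that $M[V/x]\in\mathcal T_\bot[\![B]\!]$ for all $V\in[\![A]\!]$, and $[\![A\rightharpoonup F]\!]$ is the set of closed $\lambda x.M$ such that, for every closed value $V$, $M[V/x]\in\mathcal T[\![F]\!]$ implies $V\in[\![A]\!]$. A valuation $\theta$ is a substitution of closed values for variables, defined on all free variables of the judgement. The judgement $\Gamma\vdash\Delta$ is *true*, $\Gamma\models\Delta$, if every valuation $\theta$ with $M\theta\in\mathcal T[\![A]\!]$ for all $(M:A)\in\Gamma$ satisfies $M\theta\in\mathcal T_\bot[\![A]\!]$ for some $(M:A)\in\Delta$. *Claim.* If $\Gamma\vdash\Delta$ is provable, then $\Gamma\models\Delta$. Moreover, for every closed term $M$: if $\vdash M:\mathsf{Ok}$ is provable, then $M$ does not go wrong; and if $M:\mathsf{Ok}\vdash$ is provable, then $M$ does not evaluate. -/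

import Mathlib

namespace TwoSided

/-! ### Terms

Terms up to renaming of bound variables, in well-scoped de Bruijn form: `Tm n` is the set of terms
whose free variables are among `n` given ones, numbered by `Fin n`. A binder adds a variable with
number `0` and moves the other numbers up by one. In `letp M N` (that is, `let (x, y) = M in N`)
the variable `x` has number `0` in `N` and `y` has number `1`. Closed terms are the elements of
`Tm 0`. -/
inductive Tm : ℕ → Type where
  | var {n : ℕ} (x : Fin n) : Tm n
  | zero {n : ℕ} : Tm n
  | succ {n : ℕ} (M : Tm n) : Tm n
  | pred {n : ℕ} (M : Tm n) : Tm n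
  | ifz {n : ℕ} (M N P : Tm n) : Tm n
  | lam {n : ℕ} (M : Tm (n + 1)) : Tm n
  | app {n : ℕ} (M N : Tm n) : Tm n
  | fix {n : ℕ} (M : Tm (n + 1)) : Tm n
  | pair {n : ℕ} (M N : Tm n) : Tm n
  | letp {n : ℕ} (M : Tm n) (N : Tm (n + 2)) : Tm n
  deriving DecidableEq

/-- Extend a renaming under one binder. -/
def liftRen {n m : ℕ} (ρ : Fin n → Fin m) : Fin (n + 1) → Fin (m + 1) :=
  Fin.cases 0 (fun i => (ρ i).succ)

def Tm.rename : {n m : ℕ} → (Fin n → Fin m) → Tm n → Tm m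
  | _, _, ρ, .var x => .var (ρ x)
  | _, _, _, .zero => .zero
  | _, _, ρ, .succ M => .succ (M.rename ρ)
  | _, _, ρ, .pred M => .pred (M.rename ρ)
  | _, _, ρ, .ifz M N P => .ifz (M.rename ρ) (N.rename ρ) (P.rename ρ)
  | _, _, ρ, .lam M => .lam (M.rename (liftRen ρ))
  | _, _, ρ, .app M N => .app (M.rename ρ) (N.rename ρ)
  | _, _, ρ, .fix M => .fix (M.rename (liftRen ρ))
  | _, _, ρ, .pair M N => .pair (M.rename ρ) (N.rename ρ)
  | _, _, ρ, .letp M N => .letp (M.rename ρ) (N.rename (liftRen (liftRen ρ)))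

/-- Regard a term as a term with one more variable, number `0`, which does not occur in it. -/
def Tm.wk {n : ℕ} (M : Tm n) : Tm (n + 1) := M.rename Fin.succ

/-- Extend a substitution under one binder. -/
def liftSub {n m : ℕ} (σ : Fin n → Tm m) : Fin (n + 1) → Tm (m + 1) :=
  Fin.cases (.var 0) (fun i => (σ i).wk)

/-- Simultaneous capture-avoiding substitution. -/
def Tm.subst : {n m : ℕ} → (Fin n → Tm m) → Tm n → Tm m
  | _, _, σ, .var x => σ x
  | _, _, _, .zero => .zero
  | _, _, σ, .succ M => .succ (M.subst σ)
  | _, _, σ, .pred M => .pred (M.subst σ)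
  | _, _, σ, .ifz M N P => .ifz (M.subst σ) (N.subst σ) (P.subst σ)
  | _, _, σ, .lam M => .lam (M.subst (liftSub σ))
  | _, _, σ, .app M N => .app (M.subst σ) (N.subst σ)
  | _, _, σ, .fix M => .fix (M.subst (liftSub σ))
  | _, _, σ, .pair M N => .pair (M.subst σ) (N.subst σ)
  | _, _, σ, .letp M N => .letp (M.subst σ) (N.subst (liftSub (liftSub σ)))

/-- `M[N/x]`, where `x` is the variable with number `0` of `M`. -/
def Tm.inst {n : ℕ} (M : Tm (n + 1)) (N : Tm n) : Tm n :=
  M.subst (Fin.cases N Tm.var)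

/-- `M[N/x, P/y]`, where `x` and `y` are the variables with numbers `0` and `1` of `M`. -/
def Tm.inst₂ {n : ℕ} (M : Tm (n + 2)) (N P : Tm n) : Tm n :=
  M.subst (Fin.cases N (Fin.cases P Tm.var))

/-- The numeral `succ^k(zero)`. -/
def numeral {n : ℕ} : ℕ → Tm n
  | 0 => .zero
  | k + 1 => .succ (numeral k)

inductive IsValue {n : ℕ} : Tm n → Prop where
  | var (x : Fin n) : IsValue (.var x)
  | numeral (k : ℕ) : IsValue (numeral k)
  | pair {V W : Tm n} : IsValue V → IsValue W → IsValue (.pair V W)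
  | lam (M : Tm (n + 1)) : IsValue (.lam M)

/-! ### Reduction -/

/-- One-step reduction: the seven redex schemas, closed under evaluation contexts
`E ::= □ | succ(E) | pred(E) | (E, M) | (V, E) | let (x, y) = E in N | ifz E N P | (λx.M) E | E N`
(one closure rule for each context former). -/
inductive Step {n : ℕ} : Tm n → Tm n → Prop where
  | ifZ (N P : Tm n) : Step (.ifz (numeral 0) N P) N
  | ifS (k : ℕ) (N P : Tm n) : Step (.ifz (numeral (k + 1)) N P) P
  | letp {V W : Tm n} (M : Tm (n + 2)) :
      IsValue V → IsValue W → Step (.letp (.pair V W) M) (M.inst₂ V W)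
  | fix (M : Tm (n + 1)) : Step (.fix M) (M.inst (.fix M))
  | predZ : Step (.pred (numeral 0)) (numeral 0)
  | predS (k : ℕ) : Step (.pred (numeral (k + 1))) (numeral k)
  | beta (M : Tm (n + 1)) {V : Tm n} : IsValue V → Step (.app (.lam M) V) (M.inst V)
  | ctxSucc {M M' : Tm n} : Step M M' → Step (.succ M) (.succ M')
  | ctxPred {M M' : Tm n} : Step M M' → Step (.pred M) (.pred M')
  | ctxPairL {M M' : Tm n} (N : Tm n) : Step M M' → Step (.pair M N) (.pair M' N)
  | ctxPairR {V N N' : Tm n} : IsValue V → Step N N' → Step (.pair V N) (.pair V N')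
  | ctxLet {M M' : Tm n} (N : Tm (n + 2)) : Step M M' → Step (.letp M N) (.letp M' N)
  | ctxIf {M M' : Tm n} (N P : Tm n) : Step M M' → Step (.ifz M N P) (.ifz M' N P)
  | ctxAppR (M : Tm (n + 1)) {N N' : Tm n} :
      Step N N' → Step (.app (.lam M) N) (.app (.lam M) N')
  | ctxAppL {M M' : Tm n} (N : Tm n) : Step M M' → Step (.app M N) (.app M' N)

/-- Reflexive transitive closure of one-step reduction. -/
def Steps {n : ℕ} : Tm n → Tm n → Prop := Relation.ReflTransGen Step

def IsNormal {n : ℕ} (M : Tm n) : Prop := ∀ N, ¬ Step M N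

/-- A term diverges if it has no normal form. -/
def Diverges {n : ℕ} (M : Tm n) : Prop := ¬ ∃ N, Steps M N ∧ IsNormal N

/-- A closed term evaluates to a value `V`. -/
def EvalsTo (M V : Tm 0) : Prop := Steps M V ∧ IsValue V

def Evaluates (M : Tm 0) : Prop := ∃ V, EvalsTo M V

/-- A normal form that is not a value. -/
def Stuck {n : ℕ} (M : Tm n) : Prop := IsNormal M ∧ ¬ IsValue M

def GoesWrong {n : ℕ} (M : Tm n) : Prop := ∃ N, Steps M N ∧ Stuck N

/-! ### Types -/

/-- Finitely verifiable types: `F ::= Ok | Nat | F × F`. -/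
inductive FTy : Type where
  | ok : FTy
  | nat : FTy
  | prod (F G : FTy) : FTy
  deriving DecidableEq

/-- Types: `A ::= Ok | Nat | A × B | A → B | A ⤚ F`, where `arr` is the sufficiency arrow and
`only A F` is the necessity arrow "`A` only to `F`". -/
inductive Ty : Type where
  | ok : Ty
  | nat : Ty
  | prod (A B : Ty) : Ty
  | arr (A B : Ty) : Ty
  | only (A : Ty) (F : FTy) : Ty
  deriving DecidableEq

/-- Every finitely verifiable type is a type. -/
def FTy.toTy : FTy → Ty
  | .ok => .ok
  | .nat => .nat
  | .prod F G => .prod F.toTy G.toTy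

def Ty.IsNat (A : Ty) : Prop := A = .nat

def Ty.IsProd (A : Ty) : Prop := ∃ B C, A = .prod B C

def Ty.IsArrow (A : Ty) : Prop := (∃ B C, A = .arr B C) ∨ ∃ B F, A = .only B F

/-- Disjointness of types: neither is `Ok`, and either exactly one is `Nat`, or exactly one is an
arrow (of either kind), or exactly one is a product. -/
def Ty.Disj (A B : Ty) : Prop :=
  A ≠ .ok ∧ B ≠ .ok ∧
    (Xor A.IsNat B.IsNat ∨ Xor A.IsArrow B.IsArrow ∨ Xor A.IsProd B.IsProd)

/-! ### Type assignment -/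

/-- A typing formula `M : A`. -/
structure Typing (n : ℕ) : Type where
  subject : Tm n
  type : Ty
  deriving DecidableEq

def Typing.wk {n : ℕ} (φ : Typing n) : Typing (n + 1) := ⟨φ.subject.wk, φ.type⟩

/-- The same finite set of typings, with one more variable, which is not free in it. -/
def wkSet {n : ℕ} (Γ : Finset (Typing n)) : Finset (Typing (n + 1)) := Γ.image Typing.wk

/-- Provability of two-sided judgements `Γ ⊢ Δ` (with `Ok`). `Γ, M : A` is `insert ⟨M, A⟩ Γ`. In the
premises under a binder the sets `Γ` and `Δ` appear weakened: this is the requirement that the bound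
variables are not free in `Γ` and `Δ`. -/
inductive Provable : {n : ℕ} → Finset (Typing n) → Finset (Typing n) → Prop where
  -- structural rules
  | id {n : ℕ} (Γ Δ : Finset (Typing n)) (x : Fin n) (A : Ty) :
      Provable (insert ⟨.var x, A⟩ Γ) (insert ⟨.var x, A⟩ Δ)
  | dis {n : ℕ} {Γ Δ : Finset (Typing n)} {M : Tm n} {A B : Ty} :
      A.Disj B →
      Provable Γ (insert ⟨M, B⟩ Δ) →
      Provable (insert ⟨M, A⟩ Γ) Δ
  -- right rules
  | zeroR {n : ℕ} (Γ Δ : Finset (Typing n)) :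
      Provable Γ (insert ⟨.zero, .nat⟩ Δ)
  | succR {n : ℕ} {Γ Δ : Finset (Typing n)} {M : Tm n} :
      Provable Γ (insert ⟨M, .nat⟩ Δ) →
      Provable Γ (insert ⟨.succ M, .nat⟩ Δ)
  | predR {n : ℕ} {Γ Δ : Finset (Typing n)} {M : Tm n} :
      Provable Γ (insert ⟨M, .nat⟩ Δ) →
      Provable Γ (insert ⟨.pred M, .nat⟩ Δ)
  | letR {n : ℕ} {Γ Δ : Finset (Typing n)} {M : Tm n} {N : Tm (n + 2)} {A B C : Ty} :
      Provable Γ (insert ⟨M, .prod B C⟩ Δ) →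
      Provable (insert ⟨.var 0, B⟩ (insert ⟨.var 1, C⟩ (wkSet (wkSet Γ))))
        (insert ⟨N, A⟩ (wkSet (wkSet Δ))) →
      Provable Γ (insert ⟨.letp M N, A⟩ Δ)
  | appR {n : ℕ} {Γ Δ : Finset (Typing n)} {M N : Tm n} {A B : Ty} :
      Provable Γ (insert ⟨M, .arr B A⟩ Δ) →
      Provable Γ (insert ⟨N, B⟩ Δ) →
      Provable Γ (insert ⟨.app M N, A⟩ Δ)
  | pairR {n : ℕ} {Γ Δ : Finset (Typing n)} {M N : Tm n} {A B : Ty} :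
      Provable Γ (insert ⟨M, A⟩ Δ) →
      Provable Γ (insert ⟨N, B⟩ Δ) →
      Provable Γ (insert ⟨.pair M N, .prod A B⟩ Δ)
  | absR {n : ℕ} {Γ Δ : Finset (Typing n)} {M : Tm (n + 1)} {A B : Ty} :
      Provable (insert ⟨.var 0, B⟩ (wkSet Γ)) (insert ⟨M, A⟩ (wkSet Δ)) →
      Provable Γ (insert ⟨.lam M, .arr B A⟩ Δ)
  | abnR {n : ℕ} {Γ Δ : Finset (Typing n)} {M : Tm (n + 1)} {B : Ty} {F : FTy} :
      Provable (insert ⟨M, F.toTy⟩ (wkSet Γ)) (insert ⟨.var 0, B⟩ (wkSet Δ)) →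
      Provable Γ (insert ⟨.lam M, .only B F⟩ Δ)
  | fixR {n : ℕ} {Γ Δ : Finset (Typing n)} {M : Tm (n + 1)} {A : Ty} :
      Provable (insert ⟨.var 0, A⟩ (wkSet Γ)) (insert ⟨M, A⟩ (wkSet Δ)) →
      Provable Γ (insert ⟨.fix M, A⟩ Δ)
  | ifzR {n : ℕ} {Γ Δ : Finset (Typing n)} {M N P : Tm n} {A : Ty} :
      Provable Γ (insert ⟨M, .nat⟩ Δ) →
      Provable Γ (insert ⟨N, A⟩ Δ) →
      Provable Γ (insert ⟨P, A⟩ Δ) →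
      Provable Γ (insert ⟨.ifz M N P, A⟩ Δ)
  -- left rules
  | succL {n : ℕ} {Γ Δ : Finset (Typing n)} {M : Tm n} :
      Provable (insert ⟨M, .nat⟩ Γ) Δ →
      Provable (insert ⟨.succ M, .nat⟩ Γ) Δ
  | predL {n : ℕ} {Γ Δ : Finset (Typing n)} {M : Tm n} :
      Provable (insert ⟨M, .nat⟩ Γ) Δ →
      Provable (insert ⟨.pred M, .nat⟩ Γ) Δ
  | appL {n : ℕ} {Γ Δ : Finset (Typing n)} {M N : Tm n} {B : Ty} {F : FTy} :
      Provable Γ (insert ⟨M, .only B F⟩ Δ) →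
      Provable (insert ⟨N, B⟩ Γ) Δ →
      Provable (insert ⟨.app M N, F.toTy⟩ Γ) Δ
  | pairL1 {n : ℕ} {Γ Δ : Finset (Typing n)} {M₁ M₂ : Tm n} {A₁ A₂ : Ty} :
      Provable (insert ⟨M₁, A₁⟩ Γ) Δ →
      Provable (insert ⟨.pair M₁ M₂, .prod A₁ A₂⟩ Γ) Δ
  | pairL2 {n : ℕ} {Γ Δ : Finset (Typing n)} {M₁ M₂ : Tm n} {A₁ A₂ : Ty} :
      Provable (insert ⟨M₂, A₂⟩ Γ) Δ →
      Provable (insert ⟨.pair M₁ M₂, .prod A₁ A₂⟩ Γ) Δ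
  | letL1 {n : ℕ} {Γ Δ : Finset (Typing n)} {M : Tm n} {N : Tm (n + 2)} {A : Ty} :
      Provable (insert ⟨N, A⟩ (wkSet (wkSet Γ))) (wkSet (wkSet Δ)) →
      Provable (insert ⟨.letp M N, A⟩ Γ) Δ
  | letL2 {n : ℕ} {Γ Δ : Finset (Typing n)} {M : Tm n} {N : Tm (n + 2)} {A B₁ B₂ : Ty} :
      Provable (insert ⟨M, .prod B₁ B₂⟩ Γ) Δ →
      Provable (insert ⟨N, A⟩ (wkSet (wkSet Γ))) (insert ⟨.var 0, B₁⟩ (wkSet (wkSet Δ))) →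
      Provable (insert ⟨N, A⟩ (wkSet (wkSet Γ))) (insert ⟨.var 1, B₂⟩ (wkSet (wkSet Δ))) →
      Provable (insert ⟨.letp M N, A⟩ Γ) Δ
  | ifzL1 {n : ℕ} {Γ Δ : Finset (Typing n)} {M N P : Tm n} {A : Ty} :
      Provable (insert ⟨M, .nat⟩ Γ) Δ →
      Provable (insert ⟨.ifz M N P, A⟩ Γ) Δ
  | ifzL2 {n : ℕ} {Γ Δ : Finset (Typing n)} {M N P : Tm n} {A : Ty} :
      Provable (insert ⟨N, A⟩ Γ) Δ →
      Provable (insert ⟨P, A⟩ Γ) Δ →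
      Provable (insert ⟨.ifz M N P, A⟩ Γ) Δ
  -- rules for `Ok`
  | okVarR {n : ℕ} (Γ Δ : Finset (Typing n)) (x : Fin n) :
      Provable Γ (insert ⟨.var x, .ok⟩ Δ)
  | okL {n : ℕ} {Γ Δ : Finset (Typing n)} {M : Tm n} {A : Ty} :
      Provable (insert ⟨M, .ok⟩ Γ) Δ →
      Provable (insert ⟨M, A⟩ Γ) Δ
  | okR {n : ℕ} {Γ Δ : Finset (Typing n)} {M : Tm n} {A : Ty} :
      Provable Γ (insert ⟨M, A⟩ Δ) →
      Provable Γ (insert ⟨M, .ok⟩ Δ)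
  | okApL1 {n : ℕ} {Γ Δ : Finset (Typing n)} {M N : Tm n} {F : FTy} :
      Provable (insert ⟨M, .only .ok F⟩ Γ) Δ →
      Provable (insert ⟨.app M N, .ok⟩ Γ) Δ
  | okApL2 {n : ℕ} {Γ Δ : Finset (Typing n)} {M N : Tm n} :
      Provable (insert ⟨N, .ok⟩ Γ) Δ →
      Provable (insert ⟨.app M N, .ok⟩ Γ) Δ
  | okSL {n : ℕ} {Γ Δ : Finset (Typing n)} {M : Tm n} :
      Provable (insert ⟨M, .nat⟩ Γ) Δ →
      Provable (insert ⟨.succ M, .ok⟩ Γ) Δ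
  | okPL {n : ℕ} {Γ Δ : Finset (Typing n)} {M : Tm n} :
      Provable (insert ⟨M, .nat⟩ Γ) Δ →
      Provable (insert ⟨.pred M, .ok⟩ Γ) Δ
  | okPrL1 {n : ℕ} {Γ Δ : Finset (Typing n)} {M₁ M₂ : Tm n} :
      Provable (insert ⟨M₁, .ok⟩ Γ) Δ →
      Provable (insert ⟨.pair M₁ M₂, .ok⟩ Γ) Δ
  | okPrL2 {n : ℕ} {Γ Δ : Finset (Typing n)} {M₁ M₂ : Tm n} :
      Provable (insert ⟨M₂, .ok⟩ Γ) Δ →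
      Provable (insert ⟨.pair M₁ M₂, .ok⟩ Γ) Δ

/-- A closed term is well-typed if `⊢ M : Ok`. -/
def WellTyped (M : Tm 0) : Prop := Provable ∅ {⟨M, .ok⟩}

/-- A closed term is ill-typed if `M : Ok ⊢`. -/
def IllTyped (M : Tm 0) : Prop := Provable {⟨M, .ok⟩} ∅

/-! ### Semantics -/

/-- Closed terms that evaluate to a value in `S`. -/
def EvalsInto (S : Set (Tm 0)) : Set (Tm 0) := {M | ∃ V, EvalsTo M V ∧ V ∈ S}

/-- Closed terms that evaluate to a value in `S` or diverge. -/
def EvalsIntoOrDiverges (S : Set (Tm 0)) : Set (Tm 0) := {M | M ∈ EvalsInto S ∨ Diverges M}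

/-- The closed values of a finitely verifiable type. -/
def FTy.vals : FTy → Set (Tm 0)
  | .ok => {V | IsValue V}
  | .nat => {V | ∃ k, V = numeral k}
  | .prod F G => {P | ∃ V ∈ F.vals, ∃ W ∈ G.vals, P = .pair V W}

/-- The closed values of a type. -/
def Ty.vals : Ty → Set (Tm 0)
  | .ok => {V | IsValue V}
  | .nat => {V | ∃ k, V = numeral k}
  | .prod A B => {P | ∃ V ∈ A.vals, ∃ W ∈ B.vals, P = .pair V W}
  | .arr A B => {P | ∃ M : Tm 1, P = .lam M ∧
      ∀ V, IsValue V → V ∈ A.vals → M.inst V ∈ EvalsIntoOrDiverges B.vals}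
  | .only A F => {P | ∃ M : Tm 1, P = .lam M ∧
      ∀ V, IsValue V → M.inst V ∈ EvalsInto F.vals → V ∈ A.vals}

/-- The two readings of a finitely verifiable type agree. -/
theorem FTy.vals_toTy (F : FTy) : F.toTy.vals = F.vals := by
  induction F with
  | ok => rfl
  | nat => rfl
  | prod F G ihF ihG => simp only [FTy.toTy, Ty.vals, FTy.vals, ihF, ihG]

/-- A valuation of `n` variables: a substitution of closed values for them. -/
def IsValuation {n : ℕ} (θ : Fin n → Tm 0) : Prop := ∀ x, IsValue (θ x)

/-- `θ` satisfies every formula of `Γ` on the left. -/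
def SatLeft {n : ℕ} (θ : Fin n → Tm 0) (Γ : Finset (Typing n)) : Prop :=
  ∀ φ ∈ Γ, φ.subject.subst θ ∈ EvalsInto φ.type.vals

/-- `θ` satisfies some formula of `Δ` on the right. -/
def SatRight {n : ℕ} (θ : Fin n → Tm 0) (Δ : Finset (Typing n)) : Prop :=
  ∃ φ ∈ Δ, φ.subject.subst θ ∈ EvalsIntoOrDiverges φ.type.vals

/-- Truth of a judgement. -/
def IsTrue {n : ℕ} (Γ Δ : Finset (Typing n)) : Prop :=
  ∀ θ : Fin n → Tm 0, IsValuation θ → SatLeft θ Γ → SatRight θ Δ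

end TwoSided

/-! Every rule preserves truth. Reduction is deterministic (`Step.unique`), so lying in
`EvalsIntoOrDiverges A.vals` means that every normal form of the term is in `A.vals`, and a
terminating reduction of `E[M]` factors through the normal form of `M` (`IsCtx.steps_inv`). With
these two facts all rules but `fixR` are short: a right rule composes the normal forms of the parts,
a left rule dissects a reduction to a value.

The hard rule is `fixR`. Its premise controls `L[V/x]` only for values `V` of `A`, while `fix x. L`
unfolds to `L[fix x. L/x]`, and `fix x. L` is not a value. Suppose `fix x. L` reaches a normal form
`U` in `r + 1` steps. Let `f T` be the set of normal forms of the terms `L[V'/x]` with `V'` in `T`.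
The premise says `f A.vals ⊆ A.vals`, so the iterates of `f` decrease. `Repl.simulation` replaces
occurrences of `fix x. L` by values from a deep iterate and shows that a terminating reduction
survives, at the price of at most one level of depth per step. When a replaced occurrence is
evaluated, its substitute `V` is already the normal form of some `L[V'/x]` with `V'` one level less
deep, and determinism makes `V` the counterpart of `U`.

Hence for every `m` some value of `A` arises from `U` by replacements of depth `m`.
`Ty.mem_vals_of_forall_repl` passes to the limit by induction on `A`. For `A → B` the depth lost in
a run of `n` steps is made up by starting `n` levels deeper. For the necessity arrow an observation
in `F` has to be carried from the term to its approximant, which works because membership in `F`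
only involves numerals, pairs and being a value (`Repl.mem_fty_vals`). -/

namespace TwoSided

/-! ### Renaming and substitution -/

theorem liftRen_id {n : ℕ} : liftRen (id : Fin n → Fin n) = id := by
  funext x
  refine Fin.cases rfl (fun i => rfl) x

theorem Tm.rename_id {n : ℕ} (M : Tm n) : M.rename id = M := by
  induction M <;> simp_all [Tm.rename, liftRen_id]

theorem liftRen_comp {n m l : ℕ} (ρ : Fin n → Fin m) (τ : Fin m → Fin l) :
    liftRen τ ∘ liftRen ρ = liftRen (τ ∘ ρ) := by
  funext x
  refine Fin.cases rfl (fun i => rfl) x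

theorem Tm.rename_rename {n m l : ℕ} (M : Tm n) (ρ : Fin n → Fin m) (τ : Fin m → Fin l) :
    (M.rename ρ).rename τ = M.rename (τ ∘ ρ) := by
  induction M generalizing m l <;> simp_all [Tm.rename, liftRen_comp]

theorem liftSub_comp_liftRen {n m l : ℕ} (ρ : Fin n → Fin m) (σ : Fin m → Tm l) :
    liftSub σ ∘ liftRen ρ = liftSub (σ ∘ ρ) := by
  funext x
  refine Fin.cases rfl (fun i => rfl) x

theorem Tm.subst_rename {n m l : ℕ} (M : Tm n) (ρ : Fin n → Fin m) (σ : Fin m → Tm l) :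
    (M.rename ρ).subst σ = M.subst (σ ∘ ρ) := by
  induction M generalizing m l <;> simp_all [Tm.rename, Tm.subst, liftSub_comp_liftRen]

theorem rename_liftSub {n m l : ℕ} (σ : Fin n → Tm m) (ρ : Fin m → Fin l) :
    (fun x => (liftSub σ x).rename (liftRen ρ)) = liftSub (fun x => (σ x).rename ρ) := by
  funext x
  refine Fin.cases rfl (fun i => ?_) x
  simp only [liftSub, Fin.cases_succ, Tm.wk, Tm.rename_rename]
  rfl

theorem Tm.rename_subst {n m l : ℕ} (M : Tm n) (σ : Fin n → Tm m) (ρ : Fin m → Fin l) :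
    (M.subst σ).rename ρ = M.subst (fun x => (σ x).rename ρ) := by
  induction M generalizing m l <;> simp_all [Tm.rename, Tm.subst, rename_liftSub]

theorem subst_liftSub {n m l : ℕ} (σ : Fin n → Tm m) (τ : Fin m → Tm l) :
    (fun x => (liftSub σ x).subst (liftSub τ)) = liftSub (fun x => (σ x).subst τ) := by
  funext x
  refine Fin.cases rfl (fun i => ?_) x
  simp only [liftSub, Fin.cases_succ, Tm.wk, Tm.subst_rename, Tm.rename_subst]
  rfl

theorem Tm.subst_subst {n m l : ℕ} (M : Tm n) (σ : Fin n → Tm m) (τ : Fin m → Tm l) :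
    (M.subst σ).subst τ = M.subst (fun x => (σ x).subst τ) := by
  induction M generalizing m l <;> simp_all [Tm.subst, subst_liftSub]

theorem liftSub_var {n : ℕ} : liftSub (Tm.var : Fin n → Tm n) = Tm.var := by
  funext x
  refine Fin.cases rfl (fun i => rfl) x

theorem Tm.subst_var {n : ℕ} (M : Tm n) : M.subst Tm.var = M := by
  induction M <;> simp_all [Tm.subst, liftSub_var]

theorem Tm.rename_eq_subst {n m : ℕ} (M : Tm n) (ρ : Fin n → Fin m) :
    M.rename ρ = M.subst (fun x => .var (ρ x)) := by
  rw [← Tm.subst_var (M.rename ρ), Tm.subst_rename]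
  rfl

/-- The valuation `θ` extended by `V` for the variable with number `0`. -/
abbrev extend {n m : ℕ} (V : Tm m) (θ : Fin n → Tm m) : Fin (n + 1) → Tm m :=
  Fin.cases V θ

theorem Tm.wk_subst_extend {n m : ℕ} (M : Tm n) (V : Tm m) (θ : Fin n → Tm m) :
    M.wk.subst (extend V θ) = M.subst θ := by
  rw [Tm.wk, Tm.subst_rename]
  rfl

/-- Turns a reduct of a substituted binder into an extended valuation, the form in which the
premises of the binding rules apply. -/
theorem Tm.inst_subst_liftSub {n m : ℕ} (M : Tm (n + 1)) (θ : Fin n → Tm m) (V : Tm m) :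
    (M.subst (liftSub θ)).inst V = M.subst (extend V θ) := by
  rw [Tm.inst, Tm.subst_subst]
  congr 1
  funext x
  refine Fin.cases rfl (fun i => ?_) x
  simp only [liftSub, Fin.cases_succ]
  exact (Tm.wk_subst_extend _ _ _).trans (Tm.subst_var _)

theorem Tm.inst₂_subst_liftSub {n m : ℕ} (M : Tm (n + 2)) (θ : Fin n → Tm m) (V W : Tm m) :
    (M.subst (liftSub (liftSub θ))).inst₂ V W = M.subst (extend V (extend W θ)) := by
  rw [Tm.inst₂, Tm.subst_subst]
  congr 1
  funext x
  refine Fin.cases rfl (fun i => Fin.cases rfl (fun j => ?_) i) x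
  simp only [liftSub, Fin.cases_succ]
  rw [show (θ j).wk.wk.subst _ = (θ j).wk.subst _ from Tm.wk_subst_extend _ _ _]
  exact (Tm.wk_subst_extend _ _ _).trans (Tm.subst_var _)

/-! ### Values and reduction -/

theorem numeral_injective {n : ℕ} : Function.Injective (numeral : ℕ → Tm n) := by
  intro k
  induction k with
  | zero => intro l h; cases l <;> simp_all [numeral]
  | succ k ih =>
    intro l h
    cases l with
    | zero => simp [numeral] at h
    | succ l => simp only [numeral, Tm.succ.injEq] at h; rw [ih h]

theorem numeral_inj {n k l : ℕ} : (numeral k : Tm n) = numeral l ↔ k = l :=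
  numeral_injective.eq_iff

theorem isValue_zero {n : ℕ} : IsValue (.zero : Tm n) := .numeral 0

theorem isValue_succ {n : ℕ} {M : Tm n} : IsValue (.succ M) ↔ ∃ k, M = numeral k := by
  constructor
  · intro h
    generalize hS : Tm.succ M = S at h
    cases h with
    | numeral k => cases k <;> simp_all [numeral]
    | _ => cases hS
  · rintro ⟨k, rfl⟩
    exact .numeral (k + 1)

theorem isValue_pair {n : ℕ} {M N : Tm n} : IsValue (.pair M N) ↔ IsValue M ∧ IsValue N := by
  constructor
  · intro h
    generalize hS : Tm.pair M N = S at h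
    cases h with
    | numeral k => cases k <;> simp_all [numeral]
    | pair h₁ h₂ => cases hS; exact ⟨h₁, h₂⟩
    | _ => cases hS
  · exact fun h => .pair h.1 h.2

theorem IsValue.shape {n : ℕ} {V : Tm n} (h : IsValue V) :
    (∃ x, V = .var x) ∨ (∃ k, V = TwoSided.numeral k) ∨ (∃ V₁ V₂, V = .pair V₁ V₂) ∨
      ∃ M, V = .lam M := by
  cases h <;> simp

theorem numeral_ne_pair {n k : ℕ} {M N : Tm n} : (numeral k : Tm n) ≠ .pair M N := by
  cases k <;> simp [numeral]

theorem numeral_ne_lam {n k : ℕ} {M : Tm (n + 1)} : (numeral k : Tm n) ≠ .lam M := by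
  cases k <;> simp [numeral]

/-! ### Inversion of a single step -/

section Inversion

variable {n : ℕ} {M N P X : Tm n}

theorem step_var {x : Fin n} : ¬ Step (.var x) X := nofun

theorem step_zero : ¬ Step .zero X := nofun

theorem step_lam {L : Tm (n + 1)} : ¬ Step (.lam L) X := nofun

theorem step_succ : Step (.succ M) X ↔ ∃ M', Step M M' ∧ X = .succ M' := by
  constructor
  · rintro (_ | _); exact ⟨_, ‹_›, rfl⟩
  · rintro ⟨M', h, rfl⟩; exact .ctxSucc h

theorem step_fix {L : Tm (n + 1)} : Step (.fix L) X ↔ X = L.inst (.fix L) := by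
  constructor
  · rintro (_ | _); rfl
  · rintro rfl; exact .fix L

theorem step_pred : Step (.pred M) X ↔ (M = numeral 0 ∧ X = numeral 0) ∨
    (∃ k, M = numeral (k + 1) ∧ X = numeral k) ∨ ∃ M', Step M M' ∧ X = .pred M' := by
  constructor
  · intro h
    cases h with
    | predZ => exact .inl ⟨rfl, rfl⟩
    | predS k => exact .inr (.inl ⟨k, rfl, rfl⟩)
    | ctxPred h => exact .inr (.inr ⟨_, h, rfl⟩)
  · rintro (⟨rfl, rfl⟩ | ⟨k, rfl, rfl⟩ | ⟨M', h, rfl⟩)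
    exacts [.predZ, .predS k, .ctxPred h]

theorem step_ifz : Step (.ifz M N P) X ↔ (M = numeral 0 ∧ X = N) ∨
    (∃ k, M = numeral (k + 1) ∧ X = P) ∨ ∃ M', Step M M' ∧ X = .ifz M' N P := by
  constructor
  · intro h
    cases h with
    | ifZ => exact .inl ⟨rfl, rfl⟩
    | ifS k => exact .inr (.inl ⟨k, rfl, rfl⟩)
    | ctxIf _ _ h => exact .inr (.inr ⟨_, h, rfl⟩)
  · rintro (⟨rfl, rfl⟩ | ⟨k, rfl, rfl⟩ | ⟨M', h, rfl⟩)
    exacts [.ifZ _ _, .ifS k _ _, .ctxIf _ _ h]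

theorem step_pair : Step (.pair M N) X ↔ (∃ M', Step M M' ∧ X = .pair M' N) ∨
    ∃ N', IsValue M ∧ Step N N' ∧ X = .pair M N' := by
  constructor
  · intro h
    cases h with
    | ctxPairL _ h => exact .inl ⟨_, h, rfl⟩
    | ctxPairR h h' => exact .inr ⟨_, h, h', rfl⟩
  · rintro (⟨M', h, rfl⟩ | ⟨N', h, h', rfl⟩)
    exacts [.ctxPairL _ h, .ctxPairR h h']

theorem step_letp {L : Tm (n + 2)} : Step (.letp M L) X ↔
    (∃ V W, M = .pair V W ∧ IsValue V ∧ IsValue W ∧ X = L.inst₂ V W) ∨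
      ∃ M', Step M M' ∧ X = .letp M' L := by
  constructor
  · intro h
    cases h with
    | letp _ h h' => exact .inl ⟨_, _, rfl, h, h', rfl⟩
    | ctxLet _ h => exact .inr ⟨_, h, rfl⟩
  · rintro (⟨V, W, rfl, h, h', rfl⟩ | ⟨M', h, rfl⟩)
    exacts [.letp _ h h', .ctxLet _ h]

theorem step_app : Step (.app M N) X ↔
    (∃ L, M = .lam L ∧ IsValue N ∧ X = L.inst N) ∨
      (∃ L N', M = .lam L ∧ Step N N' ∧ X = .app M N') ∨ ∃ M', Step M M' ∧ X = .app M' N := by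
  constructor
  · intro h
    cases h with
    | beta L h => exact .inl ⟨L, rfl, h, rfl⟩
    | ctxAppR L h => exact .inr (.inl ⟨L, _, rfl, h, rfl⟩)
    | ctxAppL _ h => exact .inr (.inr ⟨_, h, rfl⟩)
  · rintro (⟨L, rfl, h, rfl⟩ | ⟨L, N', rfl, h, rfl⟩ | ⟨M', h, rfl⟩)
    exacts [.beta L h, .ctxAppR L h, .ctxAppL _ h]

end Inversion

theorem isNormal_numeral {n : ℕ} (k : ℕ) : IsNormal (numeral k : Tm n) := by
  induction k with
  | zero => exact fun _ => step_zero
  | succ k ih =>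
    intro X h
    obtain ⟨M', h, -⟩ := step_succ.1 h
    exact ih _ h

theorem IsValue.isNormal {n : ℕ} {V : Tm n} (h : IsValue V) : IsNormal V := by
  induction h with
  | var x => exact fun _ => step_var
  | numeral k => exact isNormal_numeral k
  | lam M => exact fun _ => step_lam
  | pair _ _ ih₁ ih₂ =>
    intro X h
    obtain ⟨M', h, -⟩ | ⟨N', -, h, -⟩ := step_pair.1 h
    exacts [ih₁ _ h, ih₂ _ h]

/-- The contexts fix the order of evaluation: a redex schema requires normal forms in the places
where a context rule would reduce, and `(V, E)` and `(λx.M) E` become available only when the left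
component is normal. -/
theorem Step.unique {n : ℕ} {M N N' : Tm n} (h : Step M N) (h' : Step M N') : N = N' := by
  have nn (k : ℕ) (X : Tm n) : ¬ Step (numeral k) X := isNormal_numeral k X
  induction h generalizing N' with
  | ifZ | ifS =>
    rw [step_ifz] at h'
    obtain ⟨h, rfl⟩ | ⟨k, h, rfl⟩ | ⟨M', h, rfl⟩ := h'
    all_goals simp_all [numeral_inj]
  | letp M hV hW =>
    rw [step_letp] at h'
    obtain ⟨V, W, h, -, -, rfl⟩ | ⟨M', h, rfl⟩ := h'
    · cases h; rfl
    · exact absurd h ((IsValue.pair hV hW).isNormal _)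
  | fix M => exact (step_fix.1 h').symm
  | predZ | predS =>
    rw [step_pred] at h'
    obtain ⟨h, rfl⟩ | ⟨k, h, rfl⟩ | ⟨M', h, rfl⟩ := h'
    all_goals simp_all [numeral_inj]
  | beta M hV =>
    rw [step_app] at h'
    obtain ⟨L, h, -, rfl⟩ | ⟨L, N', h, hs, rfl⟩ | ⟨M', h, rfl⟩ := h'
    · cases h; rfl
    · exact absurd hs (hV.isNormal _)
    · exact absurd h step_lam
  | ctxSucc h ih =>
    obtain ⟨M', h, rfl⟩ := step_succ.1 h'
    rw [ih h]
  | ctxPred h ih =>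
    rw [step_pred] at h'
    obtain ⟨rfl, rfl⟩ | ⟨k, rfl, rfl⟩ | ⟨M', h', rfl⟩ := h'
    · exact absurd h (nn _ _)
    · exact absurd h (nn _ _)
    · rw [ih h']
  | ctxPairL N h ih =>
    obtain ⟨M', hs, rfl⟩ | ⟨N', hV, -, rfl⟩ := step_pair.1 h'
    · rw [ih hs]
    · exact absurd h (hV.isNormal _)
  | ctxPairR hV h ih =>
    obtain ⟨M', hs, rfl⟩ | ⟨N', -, hs, rfl⟩ := step_pair.1 h'
    · exact absurd hs (hV.isNormal _)
    · rw [ih hs]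
  | ctxLet N h ih =>
    obtain ⟨V, W, rfl, hV, hW, rfl⟩ | ⟨M', hs, rfl⟩ := step_letp.1 h'
    · exact absurd h ((IsValue.pair hV hW).isNormal _)
    · rw [ih hs]
  | ctxIf N P h ih =>
    rw [step_ifz] at h'
    obtain ⟨rfl, rfl⟩ | ⟨k, rfl, rfl⟩ | ⟨M', hs, rfl⟩ := h'
    · exact absurd h (nn _ _)
    · exact absurd h (nn _ _)
    · rw [ih hs]
  | ctxAppR M h ih =>
    obtain ⟨L, -, hV, rfl⟩ | ⟨L, N', -, hs, rfl⟩ | ⟨M', hs, rfl⟩ := step_app.1 h'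
    · exact absurd h (hV.isNormal _)
    · rw [ih hs]
    · exact absurd hs step_lam
  | ctxAppL N h ih =>
    obtain ⟨L, rfl, hV, rfl⟩ | ⟨L, N', rfl, hs, rfl⟩ | ⟨M', hs, rfl⟩ := step_app.1 h'
    · exact absurd h step_lam
    · exact absurd h step_lam
    · rw [ih hs]

/-- Reduction in exactly `k` steps. -/
inductive StepsN {n : ℕ} : ℕ → Tm n → Tm n → Prop where
  | refl (M : Tm n) : StepsN 0 M M
  | head {k : ℕ} {M N P : Tm n} : Step M N → StepsN k N P → StepsN (k + 1) M P

theorem StepsN.steps {n k : ℕ} {M N : Tm n} (h : StepsN k M N) : Steps M N := by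
  induction h with
  | refl => exact .refl
  | head h _ ih => exact .head h ih

theorem Steps.exists_stepsN {n : ℕ} {M N : Tm n} (h : Steps M N) : ∃ k, StepsN k M N := by
  induction h using Relation.ReflTransGen.head_induction_on with
  | refl => exact ⟨0, .refl _⟩
  | head h _ ih => exact ih.imp' (· + 1) fun k hk => .head h hk

theorem StepsN.eq_of_isNormal {n k : ℕ} {M N : Tm n} (h : StepsN k M N) (hM : IsNormal M) :
    k = 0 ∧ M = N := by
  cases h with
  | refl => exact ⟨rfl, rfl⟩
  | head h _ => exact absurd h (hM _)

theorem StepsN.of_head {n k : ℕ} {M N U : Tm n} (h : Step M N) (hU : StepsN k M U)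
    (hn : IsNormal U) : ∃ j, k = j + 1 ∧ StepsN j N U := by
  cases hU with
  | refl => exact absurd h (hn _)
  | head h' hU => obtain rfl := h.unique h'; exact ⟨_, rfl, hU⟩

/-- The length is determined as well as the result; the depth count for fixed points relies on this.
-/
theorem StepsN.unique {n k l : ℕ} {M U U' : Tm n} (h : StepsN k M U) (hU : IsNormal U)
    (h' : StepsN l M U') (hU' : IsNormal U') : k = l ∧ U = U' := by
  induction h generalizing l with
  | refl =>
    obtain ⟨rfl, rfl⟩ := h'.eq_of_isNormal hU
    exact ⟨rfl, rfl⟩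
  | head h _ ih =>
    obtain ⟨j, rfl, hj⟩ := h'.of_head h hU'
    obtain ⟨rfl, rfl⟩ := ih hU hj
    exact ⟨rfl, rfl⟩

theorem Steps.unique {n : ℕ} {M U U' : Tm n} (h : Steps M U) (hU : IsNormal U)
    (h' : Steps M U') (hU' : IsNormal U') : U = U' := by
  obtain ⟨k, h⟩ := h.exists_stepsN
  obtain ⟨l, h'⟩ := h'.exists_stepsN
  exact (h.unique hU h' hU').2

/-- `E` is an evaluation context: reduction is closed under it. -/
def IsCtx {n : ℕ} (E : Tm n → Tm n) : Prop := ∀ ⦃M M'⦄, Step M M' → Step (E M) (E M')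

theorem IsCtx.steps {n : ℕ} {E : Tm n → Tm n} (hE : IsCtx E) {M M' : Tm n} (h : Steps M M') :
    Steps (E M) (E M') :=
  h.lift E fun _ _ => @hE _ _

/-- A terminating reduction of `E[M]` starts with one of `M` to normal form. -/
theorem IsCtx.stepsN_inv {n k : ℕ} {E : Tm n → Tm n} (hE : IsCtx E) {M U : Tm n}
    (h : StepsN k (E M) U) (hU : IsNormal U) :
    ∃ i j M', i + j = k ∧ StepsN i M M' ∧ IsNormal M' ∧ StepsN j (E M') U := by
  induction k generalizing M with
  | zero =>
    refine ⟨0, 0, M, rfl, .refl M, fun M' hM => ?_, h⟩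
    cases h
    exact hU _ (hE hM)
  | succ k ih =>
    by_cases hM : IsNormal M
    · exact ⟨0, k + 1, M, by omega, .refl M, hM, h⟩
    · simp only [IsNormal, not_forall, not_not] at hM
      obtain ⟨M₁, hM⟩ := hM
      -- By determinism the first step of `E[M]` must be the one inside `M`.
      obtain ⟨j, hj, h⟩ := h.of_head (hE hM) hU
      obtain rfl : k = j := by omega
      obtain ⟨i, j, M', rfl, h₁, h₂, h₃⟩ := ih h
      exact ⟨i + 1, j, M', by omega, .head hM h₁, h₂, h₃⟩

theorem IsCtx.steps_inv {n : ℕ} {E : Tm n → Tm n} (hE : IsCtx E) {M U : Tm n}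
    (h : Steps (E M) U) (hU : IsNormal U) :
    ∃ M', Steps M M' ∧ IsNormal M' ∧ Steps (E M') U := by
  obtain ⟨k, h⟩ := h.exists_stepsN
  obtain ⟨i, j, M', -, h₁, h₂, h₃⟩ := hE.stepsN_inv h hU
  exact ⟨M', h₁.steps, h₂, h₃.steps⟩

/-! ### The evaluation contexts, one frame at a time -/

section Contexts

variable {n : ℕ}

theorem isCtx_succ : IsCtx (Tm.succ : Tm n → Tm n) := fun _ _ h => .ctxSucc h
theorem isCtx_pred : IsCtx (Tm.pred : Tm n → Tm n) := fun _ _ h => .ctxPred h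
theorem isCtx_ifz (N P : Tm n) : IsCtx (fun M => .ifz M N P) := fun _ _ h => .ctxIf N P h
theorem isCtx_letp (N : Tm (n + 2)) : IsCtx (fun M => .letp M N) := fun _ _ h => .ctxLet N h
theorem isCtx_pairL (N : Tm n) : IsCtx (fun M => .pair M N) := fun _ _ h => .ctxPairL N h
theorem isCtx_pairR {V : Tm n} (hV : IsValue V) : IsCtx (fun N => .pair V N) :=
  fun _ _ h => .ctxPairR hV h
theorem isCtx_appL (N : Tm n) : IsCtx (fun M => .app M N) := fun _ _ h => .ctxAppL N h
theorem isCtx_appR (L : Tm (n + 1)) : IsCtx (fun N => .app (.lam L) N) :=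
  fun _ _ h => .ctxAppR L h

end Contexts

/-! ### Replacing a fixed point by values -/

/-- The second term results from the first by replacing occurrences of the closed term `Φ` by
elements of `X`. -/
inductive Repl (Φ : Tm 0) (X : Set (Tm 0)) : {n : ℕ} → Tm n → Tm n → Prop where
  | base {n : ℕ} {V : Tm 0} : V ∈ X →
      Repl Φ X (Φ.rename (Fin.elim0 : Fin 0 → Fin n)) (V.rename (Fin.elim0 : Fin 0 → Fin n))
  | var {n : ℕ} (x : Fin n) : Repl Φ X (.var x) (.var x)
  | zero {n : ℕ} : Repl Φ X (.zero : Tm n) .zero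
  | succ {n : ℕ} {M M' : Tm n} : Repl Φ X M M' → Repl Φ X (.succ M) (.succ M')
  | pred {n : ℕ} {M M' : Tm n} : Repl Φ X M M' → Repl Φ X (.pred M) (.pred M')
  | ifz {n : ℕ} {M M' N N' P P' : Tm n} : Repl Φ X M M' → Repl Φ X N N' → Repl Φ X P P' →
      Repl Φ X (.ifz M N P) (.ifz M' N' P')
  | lam {n : ℕ} {M M' : Tm (n + 1)} : Repl Φ X M M' → Repl Φ X (.lam M) (.lam M')
  | app {n : ℕ} {M M' N N' : Tm n} : Repl Φ X M M' → Repl Φ X N N' →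
      Repl Φ X (.app M N) (.app M' N')
  | fix {n : ℕ} {M M' : Tm (n + 1)} : Repl Φ X M M' → Repl Φ X (.fix M) (.fix M')
  | pair {n : ℕ} {M M' N N' : Tm n} : Repl Φ X M M' → Repl Φ X N N' →
      Repl Φ X (.pair M N) (.pair M' N')
  | letp {n : ℕ} {M M' : Tm n} {N N' : Tm (n + 2)} : Repl Φ X M M' → Repl Φ X N N' →
      Repl Φ X (.letp M N) (.letp M' N')

namespace Repl

variable {Φ : Tm 0} {X Y : Set (Tm 0)}

protected theorem refl {n : ℕ} (M : Tm n) : Repl Φ X M M := by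
  induction M <;> constructor <;> assumption

theorem of_mem {V : Tm 0} (hV : V ∈ X) : Repl Φ X Φ V := by
  have h : Repl Φ X (Φ.rename (Fin.elim0 : Fin 0 → Fin 0)) (V.rename Fin.elim0) := .base hV
  rwa [Subsingleton.elim (Fin.elim0 : Fin 0 → Fin 0) id, Tm.rename_id, Tm.rename_id] at h

theorem mono (hXY : X ⊆ Y) {n : ℕ} {M M' : Tm n} (h : Repl Φ X M M') : Repl Φ Y M M' := by
  induction h <;> constructor <;> first | assumption | exact hXY ‹_›

theorem rename {n m : ℕ} {M M' : Tm n} (h : Repl Φ X M M') (ρ : Fin n → Fin m) :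
    Repl Φ X (M.rename ρ) (M'.rename ρ) := by
  induction h generalizing m with
  | base hV =>
    rw [Tm.rename_rename, Tm.rename_rename, Subsingleton.elim (ρ ∘ Fin.elim0) Fin.elim0]
    exact .base hV
  | _ => constructor <;> apply_assumption

theorem liftSub {n m : ℕ} {σ σ' : Fin n → Tm m} (h : ∀ x, Repl Φ X (σ x) (σ' x)) (x : Fin (n + 1)) :
    Repl Φ X (TwoSided.liftSub σ x) (TwoSided.liftSub σ' x) :=
  Fin.cases (.var 0) (fun i => (h i).rename Fin.succ) x

theorem subst {n m : ℕ} {M M' : Tm n} (h : Repl Φ X M M') {σ σ' : Fin n → Tm m}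
    (hσ : ∀ x, Repl Φ X (σ x) (σ' x)) : Repl Φ X (M.subst σ) (M'.subst σ') := by
  induction h generalizing m with
  | @base n V hV =>
    have e (M : Tm 0) (τ : Fin n → Tm m) :
        (M.rename (Fin.elim0 : Fin 0 → Fin n)).subst τ = M.rename Fin.elim0 := by
      rw [Tm.subst_rename, Tm.rename_eq_subst, Subsingleton.elim (τ ∘ Fin.elim0)]
    rw [e, e]
    exact .base hV
  | var x => exact hσ x
  | zero => exact .zero
  | succ _ ih => exact .succ (ih hσ)
  | pred _ ih => exact .pred (ih hσ)
  | ifz _ _ _ ih₁ ih₂ ih₃ => exact .ifz (ih₁ hσ) (ih₂ hσ) (ih₃ hσ)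
  | lam _ ih => exact .lam (ih (liftSub hσ))
  | app _ _ ih₁ ih₂ => exact .app (ih₁ hσ) (ih₂ hσ)
  | fix _ ih => exact .fix (ih (liftSub hσ))
  | pair _ _ ih₁ ih₂ => exact .pair (ih₁ hσ) (ih₂ hσ)
  | letp _ _ ih₁ ih₂ => exact .letp (ih₁ hσ) (ih₂ (liftSub (liftSub hσ)))

theorem inst {n : ℕ} {M M' : Tm (n + 1)} {N N' : Tm n} (h : Repl Φ X M M') (hN : Repl Φ X N N') :
    Repl Φ X (M.inst N) (M'.inst N') :=
  h.subst (Fin.cases hN .var)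

theorem inst₂ {n : ℕ} {M M' : Tm (n + 2)} {N N' P P' : Tm n} (h : Repl Φ X M M')
    (hN : Repl Φ X N N') (hP : Repl Φ X P P') : Repl Φ X (M.inst₂ N P) (M'.inst₂ N' P') :=
  h.subst (Fin.cases hN (Fin.cases hP .var))

/-! ### Normal forms cannot tell a fixed point from its replacement -/

variable {L : Tm 1}

/-- A fixed point always unfolds, so a normal form is never itself a replaced occurrence. This is
why the shape of a normal form survives replacement. -/
theorem not_isNormal_fix {n : ℕ} (ρ : Fin 0 → Fin n) : ¬ IsNormal ((Tm.fix L).rename ρ) :=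
  fun h => h _ (.fix _)

theorem eq_numeral_iff {n : ℕ} {M M' : Tm n} (h : Repl (.fix L) X M M') (hM : IsNormal M) (k : ℕ) :
    M = numeral k ↔ M' = numeral k := by
  induction h generalizing k with
  | base => exact absurd hM (not_isNormal_fix _)
  | succ h ih =>
    have hN := fun N hN => hM _ (Step.ctxSucc (M' := N) hN)
    cases k with
    | zero => simp [numeral]
    | succ k => simp [numeral, ih hN]
  | _ => cases k <;> simp [numeral]

theorem exists_eq_lam_iff {n : ℕ} {M M' : Tm n} (h : Repl (.fix L) X M M') (hM : IsNormal M) :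
    (∃ N, M = .lam N) ↔ ∃ N, M' = .lam N := by
  cases h with
  | base => exact absurd hM (not_isNormal_fix _)
  | _ => simp

/-- Normality of the left term is essential, since `fix x. L` is not a value but its replacement may
be. In a normal pair the second component is known to be normal only once the first is a value,
hence the order of the argument. -/
theorem isValue_iff {n : ℕ} {M M' : Tm n} (h : Repl (.fix L) X M M') (hM : IsNormal M) :
    IsValue M ↔ IsValue M' := by
  induction h with
  | base => exact absurd hM (not_isNormal_fix _)
  | var | zero => rfl
  | lam => exact ⟨fun _ => .lam _, fun _ => .lam _⟩
  | succ h ih =>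
    have hN := fun N hN => hM _ (Step.ctxSucc (M' := N) hN)
    simp only [isValue_succ, h.eq_numeral_iff hN]
  | pair h₁ h₂ ih₁ ih₂ =>
    rw [isValue_pair, isValue_pair, ih₁ fun N hN => hM _ (.ctxPairL _ hN)]
    refine and_congr_right fun hV => ih₂ fun N hN => hM _ (.ctxPairR ?_ hN)
    exact (ih₁ fun N hN => hM _ (.ctxPairL _ hN)).2 hV
  | _ =>
    constructor <;> intro h <;> exfalso
    all_goals
      obtain ⟨_, e⟩ | ⟨k, e⟩ | ⟨_, _, e⟩ | ⟨_, e⟩ := h.shape <;>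
        first | cases e | cases k <;> cases e

/-- A redex of the right term is recognised by numerals, abstractions and values in evaluation
position. The components there are normal on the left, so the same redex would already be present on
the left. -/
theorem isNormal {n : ℕ} {M M' : Tm n} (h : Repl (.fix L) X M M') (hM : IsNormal M) :
    IsNormal M' := by
  induction h with
  | base => exact absurd hM (not_isNormal_fix _)
  | var => exact hM
  | zero => exact hM
  | lam => exact fun _ => step_lam
  | fix => exact absurd (Step.fix _) (hM _)
  | succ h ih =>
    have hN := fun N hN => hM _ (Step.ctxSucc (M' := N) hN)
    intro T hT
    obtain ⟨M', hM', -⟩ := step_succ.1 hT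
    exact ih hN _ hM'
  | pred h ih =>
    have hN := fun N hN => hM _ (Step.ctxPred (M' := N) hN)
    intro T hT
    obtain ⟨e, -⟩ | ⟨k, e, -⟩ | ⟨M', hM', -⟩ := step_pred.1 hT
    · rw [← h.eq_numeral_iff hN] at e; subst e; exact hM _ .predZ
    · rw [← h.eq_numeral_iff hN] at e; subst e; exact hM _ (.predS k)
    · exact ih hN _ hM'
  | ifz h _ _ ih =>
    have hN := fun N hN => hM _ (Step.ctxIf (M' := N) _ _ hN)
    intro T hT
    obtain ⟨e, -⟩ | ⟨k, e, -⟩ | ⟨M', hM', -⟩ := step_ifz.1 hT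
    · rw [← h.eq_numeral_iff hN] at e; subst e; exact hM _ (.ifZ _ _)
    · rw [← h.eq_numeral_iff hN] at e; subst e; exact hM _ (.ifS k _ _)
    · exact ih hN _ hM'
  | app h₁ h₂ ih₁ ih₂ =>
    have hN := fun N hN => hM _ (Step.ctxAppL (M' := N) _ hN)
    intro T hT
    obtain ⟨L, e, hV, -⟩ | ⟨L, N', e, hN', -⟩ | ⟨M', hM', -⟩ := step_app.1 hT
    · obtain ⟨L', rfl⟩ := (h₁.exists_eq_lam_iff hN).2 ⟨L, e⟩
      have hN₂ := fun N hN => hM _ (Step.ctxAppR _ (N' := N) hN)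
      exact hM _ (.beta _ ((h₂.isValue_iff hN₂).2 hV))
    · obtain ⟨L', rfl⟩ := (h₁.exists_eq_lam_iff hN).2 ⟨L, e⟩
      have hN₂ := fun N hN => hM _ (Step.ctxAppR _ (N' := N) hN)
      exact ih₂ hN₂ _ hN'
    · exact ih₁ hN _ hM'
  | pair h₁ h₂ ih₁ ih₂ =>
    have hN := fun N hN => hM _ (Step.ctxPairL (M' := N) _ hN)
    intro T hT
    obtain ⟨M', hM', -⟩ | ⟨N', hV, hN', -⟩ := step_pair.1 hT
    · exact ih₁ hN _ hM'
    · exact ih₂ (fun N hN' => hM _ (.ctxPairR ((h₁.isValue_iff hN).2 hV) hN')) _ hN'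
  | letp h₁ h₂ ih₁ ih₂ =>
    have hN := fun N hN => hM _ (Step.ctxLet (M' := N) _ hN)
    intro T hT
    obtain ⟨V, W, rfl, hV, hW, -⟩ | ⟨M', hM', -⟩ := step_letp.1 hT
    · have hVW := (h₁.isValue_iff hN).2 (.pair hV hW)
      generalize hP : Tm.pair V W = P at h₁
      cases h₁ with
      | base => exact absurd hN (not_isNormal_fix _)
      | pair =>
        rw [isValue_pair] at hVW
        exact hM _ (.letp _ hVW.1 hVW.2)
      | _ => cases hP
    · exact ih₁ hN _ hM'

/-- If `X k` consists, for `k` at least the length of a terminating reduction of `fix x. L`, of values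
of `L[V/x]` with `V` in `X (k - 1)`, then terminating reductions of length at most `k` are preserved
by replacing `fix x. L` by elements of `X k`. -/
theorem simulation {X : ℕ → Set (Tm 0)} (hanti : Antitone X)
    (hX : ∀ k s U, StepsN s (.fix L) U → IsNormal U → s ≤ k → ∀ V ∈ X k,
      IsNormal V ∧ ∃ V' ∈ X (k - 1), Steps (L.inst V') V)
    {n k : ℕ} (hnk : n ≤ k) {S S' U : Tm 0} (h : Repl (.fix L) (X k) S S') (hU : StepsN n S U)
    (hn : IsNormal U) : ∃ U', Steps S' U' ∧ Repl (.fix L) (X (k - n)) U U' := by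
  -- Lexicographic induction on the length of the reduction and the size of the term: evaluating a
  -- subterm may use up all `n` steps, but then the term is smaller.
  induction n using Nat.strong_induction_on generalizing k S S' U with | _ n ihn
  induction hs : sizeOf S using Nat.strong_induction_on generalizing k S S' U with | _ s ihs
  subst hs
  have ih {i : ℕ} {R R' W : Tm 0} (hi : i ≤ n) (hR : sizeOf R < sizeOf S) {k : ℕ} (hik : i ≤ k)
      (h : Repl (.fix L) (X k) R R') (hW : StepsN i R W) (hWn : IsNormal W) :
      ∃ U', Steps R' U' ∧ Repl (.fix L) (X (k - i)) W U' := by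
    obtain hi | rfl := hi.lt_or_eq
    · exact ihn i hi hik h hW hWn
    · exact ihs _ hR hik h hW hWn rfl
  -- Common end of the cases: once the active subterms are normal, after `i` steps, only the next
  -- step has to be matched, and the rest is a strictly shorter reduction.
  have go {i j : ℕ} {R R' : Tm 0} (hij : i + j = n) (hS' : Steps S' R')
      (hR : Repl (.fix L) (X (k - i)) R R') (hj : StepsN j R U)
      (hstep : ∀ T, Step R T → ∃ T', Step R' T' ∧ Repl (.fix L) (X (k - i)) T T') :
      ∃ U', Steps S' U' ∧ Repl (.fix L) (X (k - n)) U U' := by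
    cases hj with
    | refl => exact ⟨R', hS', by rwa [← hij]⟩
    | @head j _ T _ hT hj =>
      obtain ⟨T', hT', hTT⟩ := hstep T hT
      obtain ⟨U', h₁, h₂⟩ := ihn j (by omega) (by omega : j ≤ k - i) hTT hj hn
      exact ⟨U', hS'.trans (.head hT' h₁), h₂.mono (hanti (by omega))⟩
  have weaken {a b : ℕ} (hab : a ≤ b) {m : ℕ} {M N : Tm m} (h : Repl (.fix L) (X b) M N) :
      Repl (.fix L) (X a) M N := h.mono (hanti hab)
  generalize hΦ : Tm.fix L = Φ at h
  cases h with
  | @base _ V hV =>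
    subst hΦ
    rw [Subsingleton.elim (Fin.elim0 : Fin 0 → Fin 0) id, Tm.rename_id] at *
    -- The crucial case: `fix x. L` is evaluated where the other term has `V`. Simulating the
    -- unfolding with `V'` in place of `fix x. L` leads to a counterpart of `U`, which is `V` by
    -- uniqueness of normal forms. So `V` needs no step at all.
    obtain ⟨hVn, V', hV', hsteps⟩ := hX k n U hU hn hnk V hV
    obtain ⟨j, rfl, hj⟩ := hU.of_head (.fix L) hn
    obtain ⟨U', h₁, h₂⟩ := ihn j (by omega) (by omega : j ≤ k - 1)
      ((Repl.refl L).inst (.of_mem hV')) hj hn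
    obtain rfl := h₁.unique (h₂.isNormal hn) hsteps hVn
    exact ⟨_, .refl, h₂.mono (hanti (by omega))⟩
  | var x => exact x.elim0
  | zero =>
    subst hΦ
    exact go (i := 0) (by omega) .refl .zero hU fun T hT => absurd hT step_zero
  | lam h =>
    subst hΦ
    exact go (i := 0) (by omega) .refl (.lam h) hU fun T hT => absurd hT step_lam
  | @fix _ M M' h =>
    subst hΦ
    refine go (i := 0) (by omega) .refl (.fix h) hU fun T hT => ⟨_, .fix _, ?_⟩
    obtain rfl := step_fix.1 hT
    exact h.inst (.fix h)
  | @succ _ M M' h =>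
    subst hΦ
    obtain ⟨i, j, M₁, hij, hi, hn₁, hj⟩ := isCtx_succ.stepsN_inv hU hn
    obtain ⟨M₁', h₁, h₂⟩ := ih (by omega) (by simp) (by omega) h hi hn₁
    refine go hij (isCtx_succ.steps h₁) (.succ h₂) hj fun T hT => ?_
    obtain ⟨_, hs, -⟩ := step_succ.1 hT
    exact absurd hs (hn₁ _)
  | @pred _ M M' h =>
    subst hΦ
    obtain ⟨i, j, M₁, hij, hi, hn₁, hj⟩ := isCtx_pred.stepsN_inv hU hn
    obtain ⟨M₁', h₁, h₂⟩ := ih (by omega) (by simp) (by omega) h hi hn₁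
    refine go hij (isCtx_pred.steps h₁) (.pred h₂) hj fun T hT => ?_
    obtain ⟨e, rfl⟩ | ⟨l, e, rfl⟩ | ⟨_, hs, -⟩ := step_pred.1 hT
    · rw [h₂.eq_numeral_iff hn₁] at e; subst e; exact ⟨_, .predZ, .refl _⟩
    · rw [h₂.eq_numeral_iff hn₁] at e; subst e; exact ⟨_, .predS l, .refl _⟩
    · exact absurd hs (hn₁ _)
  | @ifz _ M M' N N' P P' h hN hP =>
    subst hΦ
    obtain ⟨i, j, M₁, hij, hi, hn₁, hj⟩ := (isCtx_ifz N P).stepsN_inv hU hn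
    obtain ⟨M₁', h₁, h₂⟩ := ih (by omega) (by simp; omega) (by omega) h hi hn₁
    have hN := weaken (k.sub_le i) hN
    have hP := weaken (k.sub_le i) hP
    refine go hij ((isCtx_ifz N' P').steps h₁) (.ifz h₂ hN hP) hj fun T hT => ?_
    obtain ⟨e, rfl⟩ | ⟨l, e, rfl⟩ | ⟨_, hs, -⟩ := step_ifz.1 hT
    · rw [h₂.eq_numeral_iff hn₁] at e; subst e; exact ⟨_, .ifZ _ _, hN⟩
    · rw [h₂.eq_numeral_iff hn₁] at e; subst e; exact ⟨_, .ifS l _ _, hP⟩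
    · exact absurd hs (hn₁ _)
  | @app _ M M' N N' h hN =>
    subst hΦ
    obtain ⟨i, j, M₁, hij, hi, hn₁, hj⟩ := (isCtx_appL N).stepsN_inv hU hn
    obtain ⟨M₁', h₁, h₂⟩ := ih (by omega) (by simp; omega) (by omega) h hi hn₁
    have hN := weaken (k.sub_le i) hN
    -- The argument is evaluated only if the function part has become an abstraction; otherwise the
    -- application is stuck.
    by_cases hlam : ∃ Q, M₁ = .lam Q
    · obtain ⟨Q, rfl⟩ := hlam
      obtain ⟨Q', rfl⟩ := (h₂.exists_eq_lam_iff hn₁).1 ⟨Q, rfl⟩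
      obtain ⟨i', j', N₁, hij', hi', hn₁', hj'⟩ := (isCtx_appR Q).stepsN_inv hj hn
      obtain ⟨N₁', h₁', h₂'⟩ := ih (by omega) (by simp) (by omega) hN hi' hn₁'
      rw [Nat.sub_sub] at h₂'
      have h₃ := weaken (by omega : k - (i + i') ≤ k - i) h₂
      refine go (by omega) (((isCtx_appL N').steps h₁).trans ((isCtx_appR Q').steps h₁'))
        (.app h₃ h₂') hj' fun T hT => ?_
      obtain ⟨_, e, hV, rfl⟩ | ⟨_, _, -, hs, -⟩ | ⟨_, hs, -⟩ := step_app.1 hT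
      · cases e
        cases h₃ with
        | lam h₃ => exact ⟨_, .beta _ ((h₂'.isValue_iff hn₁').1 hV), h₃.inst h₂'⟩
      · exact absurd hs (hn₁' _)
      · exact absurd hs (hn₁ _)
    · refine go hij ((isCtx_appL N').steps h₁) (.app h₂ hN) hj fun T hT => ?_
      obtain ⟨Q, e, -⟩ | ⟨Q, _, e, -⟩ | ⟨_, hs, -⟩ := step_app.1 hT
      · exact absurd ⟨Q, e⟩ hlam
      · exact absurd ⟨Q, e⟩ hlam
      · exact absurd hs (hn₁ _)
  | @pair _ M M' N N' h hN =>
    subst hΦ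
    obtain ⟨i, j, M₁, hij, hi, hn₁, hj⟩ := (isCtx_pairL N).stepsN_inv hU hn
    obtain ⟨M₁', h₁, h₂⟩ := ih (by omega) (by simp; omega) (by omega) h hi hn₁
    have hN := weaken (k.sub_le i) hN
    by_cases hV : IsValue M₁
    · have hV' := (h₂.isValue_iff hn₁).1 hV
      obtain ⟨i', j', N₁, hij', hi', hn₁', hj'⟩ := (isCtx_pairR hV).stepsN_inv hj hn
      obtain ⟨N₁', h₁', h₂'⟩ := ih (by omega) (by simp) (by omega) hN hi' hn₁'
      rw [Nat.sub_sub] at h₂'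
      have h₃ := weaken (by omega : k - (i + i') ≤ k - i) h₂
      refine go (by omega) (((isCtx_pairL N').steps h₁).trans ((isCtx_pairR hV').steps h₁'))
        (.pair h₃ h₂') hj' fun T hT => ?_
      obtain ⟨_, hs, -⟩ | ⟨_, -, hs, -⟩ := step_pair.1 hT
      exacts [absurd hs (hn₁ _), absurd hs (hn₁' _)]
    · refine go hij ((isCtx_pairL N').steps h₁) (.pair h₂ hN) hj fun T hT => ?_
      obtain ⟨_, hs, -⟩ | ⟨_, hV₁, -⟩ := step_pair.1 hT
      exacts [absurd hs (hn₁ _), absurd hV₁ hV]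
  | @letp _ M M' N N' h hN =>
    subst hΦ
    obtain ⟨i, j, M₁, hij, hi, hn₁, hj⟩ := (isCtx_letp N).stepsN_inv hU hn
    obtain ⟨M₁', h₁, h₂⟩ := ih (by omega) (by simp; omega) (by omega) h hi hn₁
    have hN := weaken (k.sub_le i) hN
    refine go hij ((isCtx_letp N').steps h₁) (.letp h₂ hN) hj fun T hT => ?_
    obtain ⟨V, W, rfl, hV, hW, rfl⟩ | ⟨_, hs, -⟩ := step_letp.1 hT
    · have hVW := (h₂.isValue_iff hn₁).1 (.pair hV hW)
      cases h₂ with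
      | pair hV' hW' =>
        rw [isValue_pair] at hVW
        exact ⟨_, .letp _ hVW.1 hVW.2, hN.inst₂ hV' hW'⟩
    · exact absurd hs (hn₁ _)

end Repl

/-! ### Terminating reductions of compound terms -/

theorem Steps.eq_of_isNormal {n : ℕ} {M N : Tm n} (h : Steps M N) (hM : IsNormal M) : N = M := by
  obtain ⟨k, h⟩ := h.exists_stepsN
  exact (h.eq_of_isNormal hM).2.symm

theorem Steps.of_head {n : ℕ} {M N U : Tm n} (h : Steps M U) (hU : IsNormal U) (hN : Step M N) :
    Steps N U := by
  obtain ⟨k, h⟩ := h.exists_stepsN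
  obtain ⟨j, -, h⟩ := h.of_head hN hU
  exact h.steps

theorem not_isValue_pred {n : ℕ} {M : Tm n} : ¬ IsValue (.pred M) := fun h => by
  obtain ⟨_, e⟩ | ⟨k, e⟩ | ⟨_, _, e⟩ | ⟨_, e⟩ := h.shape <;>
    first | cases e | cases k <;> cases e

theorem not_isValue_ifz {n : ℕ} {M N P : Tm n} : ¬ IsValue (.ifz M N P) := fun h => by
  obtain ⟨_, e⟩ | ⟨k, e⟩ | ⟨_, _, e⟩ | ⟨_, e⟩ := h.shape <;>
    first | cases e | cases k <;> cases e

theorem not_isValue_app {n : ℕ} {M N : Tm n} : ¬ IsValue (.app M N) := fun h => by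
  obtain ⟨_, e⟩ | ⟨k, e⟩ | ⟨_, _, e⟩ | ⟨_, e⟩ := h.shape <;>
    first | cases e | cases k <;> cases e

theorem not_isValue_letp {n : ℕ} {M : Tm n} {N : Tm (n + 2)} : ¬ IsValue (.letp M N) := fun h => by
  obtain ⟨_, e⟩ | ⟨k, e⟩ | ⟨_, _, e⟩ | ⟨_, e⟩ := h.shape <;>
    first | cases e | cases k <;> cases e

/-! ### Dissecting reductions to a normal form or value -/

section Inversion

variable {n : ℕ} {M N P U : Tm n}

theorem Steps.succ_inv (h : Steps (.succ M) U) (hU : IsNormal U) :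
    ∃ M', Steps M M' ∧ IsNormal M' ∧ U = .succ M' := by
  obtain ⟨M', h₁, hn, h₂⟩ := isCtx_succ.steps_inv h hU
  refine ⟨M', h₁, hn, h₂.eq_of_isNormal fun X hX => ?_⟩
  obtain ⟨_, hs, -⟩ := step_succ.1 hX
  exact hn _ hs

theorem Steps.succ_value_inv (h : Steps (.succ M) U) (hU : IsValue U) :
    ∃ k, Steps M (numeral k) := by
  obtain ⟨M', h₁, -, rfl⟩ := h.succ_inv hU.isNormal
  obtain ⟨k, rfl⟩ := isValue_succ.1 hU
  exact ⟨k, h₁⟩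

theorem Steps.pred_value_inv (h : Steps (.pred M) U) (hU : IsValue U) :
    ∃ k, Steps M (numeral k) := by
  obtain ⟨M', h₁, hn, h₂⟩ := isCtx_pred.steps_inv h hU.isNormal
  obtain rfl | ⟨T, hT, -⟩ := h₂.cases_head
  · exact absurd hU not_isValue_pred
  · obtain ⟨rfl, -⟩ | ⟨k, rfl, -⟩ | ⟨_, hs, -⟩ := step_pred.1 hT
    exacts [⟨_, h₁⟩, ⟨_, h₁⟩, absurd hs (hn _)]

theorem Steps.ifz_value_inv (h : Steps (.ifz M N P) U) (hU : IsValue U) :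
    ∃ k, Steps M (numeral k) ∧ (Steps N U ∨ Steps P U) := by
  obtain ⟨M', h₁, hn, h₂⟩ := (isCtx_ifz N P).steps_inv h hU.isNormal
  obtain rfl | ⟨T, hT, h₃⟩ := h₂.cases_head
  · exact absurd hU not_isValue_ifz
  · obtain ⟨rfl, rfl⟩ | ⟨k, rfl, rfl⟩ | ⟨_, hs, -⟩ := step_ifz.1 hT
    exacts [⟨_, h₁, .inl h₃⟩, ⟨_, h₁, .inr h₃⟩, absurd hs (hn _)]

theorem Steps.app_value_inv (h : Steps (.app M N) U) (hU : IsValue U) :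
    ∃ L V, Steps M (.lam L) ∧ Steps N V ∧ IsValue V ∧ Steps (L.inst V) U := by
  obtain ⟨M', h₁, hn, h₂⟩ := (isCtx_appL N).steps_inv h hU.isNormal
  have hM' : ∃ L, M' = .lam L := by
    obtain rfl | ⟨T, hT, h₃⟩ := h₂.cases_head
    · exact absurd hU not_isValue_app
    · obtain ⟨L, e, -⟩ | ⟨L, _, e, -⟩ | ⟨_, hs, -⟩ := step_app.1 hT
      exacts [⟨L, e⟩, ⟨L, e⟩, absurd hs (hn _)]
  obtain ⟨L, rfl⟩ := hM'
  obtain ⟨N', h₃, hn', h₄⟩ := (isCtx_appR L).steps_inv h₂ hU.isNormal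
  obtain rfl | ⟨T, hT, h₅⟩ := h₄.cases_head
  · exact absurd hU not_isValue_app
  · obtain ⟨_, e, hV, rfl⟩ | ⟨_, _, -, hs, -⟩ | ⟨_, hs, -⟩ := step_app.1 hT
    · cases e
      exact ⟨L, N', h₁, h₃, hV, h₅⟩
    · exact absurd hs (hn' _)
    · exact absurd hs (hn _)

theorem Steps.letp_value_inv {L : Tm (n + 2)} (h : Steps (.letp M L) U) (hU : IsValue U) :
    ∃ V W, Steps M (.pair V W) ∧ IsValue V ∧ IsValue W ∧ Steps (L.inst₂ V W) U := by
  obtain ⟨M', h₁, hn, h₂⟩ := (isCtx_letp L).steps_inv h hU.isNormal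
  obtain rfl | ⟨T, hT, h₃⟩ := h₂.cases_head
  · exact absurd hU not_isValue_letp
  · obtain ⟨V, W, rfl, hV, hW, rfl⟩ | ⟨_, hs, -⟩ := step_letp.1 hT
    exacts [⟨V, W, h₁, hV, hW, h₃⟩, absurd hs (hn _)]

/-- If the left component gets stuck, the right one is never touched, so its normal form is
available only in the value case. -/
theorem Steps.pair_inv (h : Steps (.pair M N) U) (hU : IsNormal U) :
    ∃ M', Steps M M' ∧ IsNormal M' ∧
      (IsValue M' → ∃ N', Steps N N' ∧ IsNormal N' ∧ U = .pair M' N') ∧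
      (¬ IsValue M' → U = .pair M' N) := by
  obtain ⟨M', h₁, hn, h₂⟩ := (isCtx_pairL N).steps_inv h hU
  refine ⟨M', h₁, hn, fun hV => ?_, fun hV => h₂.eq_of_isNormal fun X hX => ?_⟩
  · obtain ⟨N', h₃, hn', h₄⟩ := (isCtx_pairR hV).steps_inv h₂ hU
    refine ⟨N', h₃, hn', h₄.eq_of_isNormal fun X hX => ?_⟩
    obtain ⟨_, hs, -⟩ | ⟨_, -, hs, -⟩ := step_pair.1 hX
    exacts [hn _ hs, hn' _ hs]
  · obtain ⟨_, hs, -⟩ | ⟨_, hV', -⟩ := step_pair.1 hX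
    exacts [hn _ hs, hV hV']

theorem Steps.pair_value_inv (h : Steps (.pair M N) U) (hU : IsValue U) :
    ∃ V W, Steps M V ∧ IsValue V ∧ Steps N W ∧ IsValue W ∧ U = .pair V W := by
  obtain ⟨M', h₁, -, hV, hV'⟩ := h.pair_inv hU.isNormal
  by_cases hM : IsValue M'
  · obtain ⟨N', h₂, -, rfl⟩ := hV hM
    exact ⟨M', N', h₁, hM, h₂, (isValue_pair.1 hU).2, rfl⟩
  · rw [hV' hM, isValue_pair] at hU
    exact absurd hU.1 hM

end Inversion

/-! ### Membership in the interpretation of a type -/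

theorem Ty.isValue_of_mem_vals {A : Ty} {V : Tm 0} (h : V ∈ A.vals) : IsValue V := by
  induction A generalizing V with
  | ok => exact h
  | nat => obtain ⟨k, rfl⟩ := h; exact .numeral k
  | prod A B ihA ihB => obtain ⟨V, hV, W, hW, rfl⟩ := h; exact .pair (ihA hV) (ihB hW)
  | arr A B => obtain ⟨M, rfl, -⟩ := h; exact .lam M
  | only A F => obtain ⟨M, rfl, -⟩ := h; exact .lam M

theorem mem_evalsInto {A : Ty} {M : Tm 0} :
    M ∈ EvalsInto A.vals ↔ ∃ V ∈ A.vals, Steps M V :=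
  ⟨fun ⟨V, h, hV⟩ => ⟨V, hV, h.1⟩, fun ⟨V, hV, h⟩ => ⟨V, ⟨h, A.isValue_of_mem_vals hV⟩, hV⟩⟩

/-- Uniqueness of normal forms merges "evaluates into or diverges" into one universal condition, the
working form for the right rules. -/
theorem mem_evalsIntoOrDiverges {A : Ty} {M : Tm 0} :
    M ∈ EvalsIntoOrDiverges A.vals ↔ ∀ U, Steps M U → IsNormal U → U ∈ A.vals := by
  constructor
  · rintro (⟨V, ⟨h, hV⟩, hA⟩ | h) U hU hn
    · rwa [hU.unique hn h hV.isNormal]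
    · exact absurd ⟨U, hU, hn⟩ h
  · intro h
    refine or_iff_not_imp_right.2 fun hd => ?_
    obtain ⟨U, hU, hn⟩ := not_not.1 hd
    exact mem_evalsInto.2 ⟨U, h U hU hn, hU⟩

theorem mem_evalsIntoOrDiverges_of_mem {A : Ty} {V : Tm 0} (h : V ∈ A.vals) :
    V ∈ EvalsIntoOrDiverges A.vals :=
  .inl (mem_evalsInto.2 ⟨V, h, .refl⟩)

theorem IsValue.mem_evalsIntoOrDiverges_iff {A : Ty} {V : Tm 0} (hV : IsValue V) :
    V ∈ EvalsIntoOrDiverges A.vals ↔ V ∈ A.vals :=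
  ⟨fun h => mem_evalsIntoOrDiverges.1 h V .refl hV.isNormal, mem_evalsIntoOrDiverges_of_mem⟩

theorem diverges_fix_var : Diverges (.fix (.var 0) : Tm 0) := by
  have h : ∀ N : Tm 0, Steps (.fix (.var 0)) N → N = .fix (.var 0) := by
    intro N h
    induction h with
    | refl => rfl
    | tail _ h ih => subst ih; exact step_fix.1 h
  rintro ⟨N, hN, hn⟩
  rw [h N hN] at hn
  exact hn _ (.fix _)

/-- Supplies the starting value for approximating a fixed point. An abstraction with diverging body
lies in every arrow type: divergence is allowed for the sufficiency arrow and makes the necessity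
arrow vacuous. -/
theorem Ty.vals_nonempty (A : Ty) : A.vals.Nonempty := by
  have hinst (V : Tm 0) : (Tm.fix (.var 0) : Tm 1).inst V = .fix (.var 0) := rfl
  induction A with
  | ok => exact ⟨.zero, isValue_zero⟩
  | nat => exact ⟨.zero, 0, rfl⟩
  | prod A B ihA ihB =>
    obtain ⟨V, hV⟩ := ihA
    obtain ⟨W, hW⟩ := ihB
    exact ⟨_, V, hV, W, hW, rfl⟩
  | arr A B =>
    refine ⟨_, .fix (.var 0), rfl, fun V _ _ => .inr ?_⟩
    rw [hinst]
    exact diverges_fix_var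
  | only A F =>
    refine ⟨_, .fix (.var 0), rfl, fun V _ ⟨W, h, _⟩ => ?_⟩
    rw [hinst] at h
    exact absurd ⟨W, h.1, h.2.isNormal⟩ diverges_fix_var

/-- Numerals, pairs and abstractions have different head constructors, and `Ok`, the only type that
mixes them, is excluded. -/
theorem Ty.Disj.not_mem {A B : Ty} (h : A.Disj B) {V : Tm 0} (hA : V ∈ A.vals) : V ∉ B.vals := by
  intro hB
  obtain ⟨hA', hB', h⟩ := h
  cases A <;> cases B <;>
    simp_all [Ty.IsNat, Ty.IsArrow, Ty.IsProd, Ty.vals] <;>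
    grind [numeral_ne_pair, numeral_ne_lam]

/-! ### Fixed points -/

/-- The point of finite verifiability: no arrow occurs in `F`, so membership is never tested by
running a function body and depends only on data that replacement preserves. -/
theorem Repl.mem_fty_vals {L : Tm 1} {X : Set (Tm 0)} {F : FTy} {U U' : Tm 0}
    (h : Repl (.fix L) X U U') (hU : U ∈ F.vals) : U' ∈ F.vals := by
  have hn : ∀ {F : FTy} {U : Tm 0}, U ∈ F.vals → IsValue U := fun {F} {U} h =>
    F.toTy.isValue_of_mem_vals (by rwa [F.vals_toTy])
  induction F generalizing U U' with
  | ok => exact (h.isValue_iff hU.isNormal).1 hU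
  | nat =>
    obtain ⟨k, rfl⟩ := hU
    exact ⟨k, (h.eq_numeral_iff (isNormal_numeral k) k).1 rfl⟩
  | prod F G ihF ihG =>
    obtain ⟨V, hV, W, hW, rfl⟩ := hU
    cases h with
    | pair h₁ h₂ => exact ⟨_, ihF h₁ hV, _, ihG h₂ hW, rfl⟩

section Fix

variable {L : Tm 1} {X : ℕ → Set (Tm 0)}

/-- The interpretation of a type is closed under limits of approximations. -/
theorem Ty.mem_vals_of_forall_repl (hanti : Antitone X)
    (hX : ∀ k s U, StepsN s (.fix L) U → IsNormal U → s ≤ k → ∀ V ∈ X k,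
      IsNormal V ∧ ∃ V' ∈ X (k - 1), Steps (L.inst V') V)
    {A : Ty} {U : Tm 0} (hU : IsNormal U)
    (h : ∀ m, ∃ V ∈ A.vals, Repl (.fix L) (X m) U V) : U ∈ A.vals := by
  have hval : IsValue U := by
    obtain ⟨V, hV, hUV⟩ := h 0
    exact (hUV.isValue_iff hU).2 (A.isValue_of_mem_vals hV)
  induction A generalizing U with
  | ok => exact hval
  | nat =>
    obtain ⟨V, ⟨k, rfl⟩, hUV⟩ := h 0
    exact ⟨k, (hUV.eq_numeral_iff hU k).2 rfl⟩
  | prod A B ihA ihB =>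
    have h' : ∀ m, ∃ U₁ U₂, U = .pair U₁ U₂ ∧ (∃ V ∈ A.vals, Repl (.fix L) (X m) U₁ V) ∧
        ∃ V ∈ B.vals, Repl (.fix L) (X m) U₂ V := by
      intro m
      obtain ⟨_, ⟨V, hV, W, hW, rfl⟩, hUV⟩ := h m
      generalize hP : Tm.pair V W = P at hUV
      cases hUV with
      | base => exact absurd hU (Repl.not_isNormal_fix _)
      | pair h₁ h₂ => cases hP; exact ⟨_, _, rfl, ⟨V, hV, h₁⟩, ⟨W, hW, h₂⟩⟩
      | _ => cases hP
    obtain ⟨U₁, U₂, rfl, -⟩ := h' 0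
    rw [isValue_pair] at hval
    refine ⟨U₁, ihA hval.1.isNormal (fun m => ?_) hval.1, U₂,
      ihB hval.2.isNormal (fun m => ?_) hval.2, rfl⟩
    all_goals
      obtain ⟨_, _, e, h₁, h₂⟩ := h' m
      cases e
      assumption
  | arr A B ihA ihB =>
    obtain ⟨_, ⟨_, rfl, -⟩, hUV⟩ := h 0
    obtain ⟨N, rfl⟩ := (hUV.exists_eq_lam_iff hU).2 ⟨_, rfl⟩
    refine ⟨N, rfl, fun W hW hWA => mem_evalsIntoOrDiverges.2 fun Z hZ hZn => ?_⟩
    obtain ⟨n, hn⟩ := hZ.exists_stepsN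
    have hB : ∀ m, ∃ V ∈ B.vals, Repl (.fix L) (X m) Z V := by
      intro m
      -- The run to `Z` costs up to `n` levels, so depth `m + n` leaves `m`. The argument `W` is
      -- kept unchanged, so no induction hypothesis for the domain is used.
      obtain ⟨_, ⟨N', rfl, hN'⟩, hNN'⟩ := h (m + n)
      cases hNN' with
      | lam hNN' =>
        obtain ⟨Z', hZ', hZZ'⟩ := Repl.simulation hanti hX (by omega : n ≤ m + n)
          (hNN'.inst (.refl W)) hn hZn
        rw [Nat.add_sub_cancel] at hZZ'
        exact ⟨Z', mem_evalsIntoOrDiverges.1 (hN' W hW hWA) Z' hZ' (hZZ'.isNormal hZn), hZZ'⟩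
    obtain ⟨V, hV, hZV⟩ := hB 0
    exact ihB hZn hB ((hZV.isValue_iff hZn).2 (B.isValue_of_mem_vals hV))
  | only A F =>
    obtain ⟨_, ⟨_, rfl, -⟩, hUV⟩ := h 0
    obtain ⟨N, rfl⟩ := (hUV.exists_eq_lam_iff hU).2 ⟨_, rfl⟩
    refine ⟨N, rfl, fun W hW ⟨Z, ⟨hZ, hZv⟩, hZF⟩ => ?_⟩
    obtain ⟨n, hn⟩ := hZ.exists_stepsN
    -- A single approximant suffices here: any remaining depth will do for `F`, and the conclusion
    -- concerns the unchanged `W`.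
    obtain ⟨_, ⟨N', rfl, hN'⟩, hNN'⟩ := h n
    cases hNN' with
    | lam hNN' =>
      obtain ⟨Z', hZ', hZZ'⟩ := Repl.simulation hanti hX le_rfl (hNN'.inst (.refl W)) hn
        hZv.isNormal
      exact hN' W hW ⟨Z', ⟨hZ', (hZZ'.isValue_iff hZv.isNormal).1 hZv⟩, hZZ'.mem_fty_vals hZF⟩

end Fix

/-- Semantic content of `fixR`. If the fixed point terminates, its length of evaluation sets the
offset of a decreasing chain of approximations, and its normal form is a limit of their elements. -/
theorem fix_mem_evalsIntoOrDiverges {L : Tm 1} {A : Ty}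
    (h : ∀ V ∈ A.vals, L.inst V ∈ EvalsIntoOrDiverges A.vals) :
    Tm.fix L ∈ EvalsIntoOrDiverges A.vals := by
  refine mem_evalsIntoOrDiverges.2 fun U hU hn => ?_
  obtain ⟨s, hs⟩ := hU.exists_stepsN
  obtain ⟨r, rfl, hr⟩ := hs.of_head (.fix L) hn
  let f : Set (Tm 0) → Set (Tm 0) := fun T => {V | IsNormal V ∧ ∃ V' ∈ T, Steps (L.inst V') V}
  have hmono : Monotone f := fun S T hST V hV => ⟨hV.1, hV.2.imp fun V' h => ⟨hST h.1, h.2⟩⟩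
  have hA : f A.vals ≤ A.vals := fun V ⟨hV, V', hV', hs⟩ =>
    mem_evalsIntoOrDiverges.1 (h V' hV') V hs hV
  have hiter : Antitone fun k => f^[k] A.vals := hmono.antitone_iterate_of_map_le hA
  -- The shift by `r` keeps `X` constant up to `k = r`. A full evaluation of `fix x. L` takes `r +
  -- 1` steps, so descending one level is demanded only for `k ≥ r + 1`, where `k - r` is positive.
  let X : ℕ → Set (Tm 0) := fun k => f^[k - r] A.vals
  have hanti : Antitone X := fun a b hab => hiter (Nat.sub_le_sub_right hab r)
  have hX : ∀ k s U, StepsN s (.fix L) U → IsNormal U → s ≤ k → ∀ V ∈ X k,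
      IsNormal V ∧ ∃ V' ∈ X (k - 1), Steps (L.inst V') V := by
    intro k s U' hs' hn' hk V hV
    obtain ⟨rfl, rfl⟩ := hs'.unique hn' hs hn
    obtain ⟨j, rfl⟩ := Nat.exists_eq_add_of_le hk
    have e₁ : r + 1 + j - r = j + 1 := by omega
    have e₂ : r + 1 + j - 1 - r = j := by omega
    simp only [X, e₁, Function.iterate_succ_apply'] at hV
    simp only [X, e₂]
    exact hV
  have hne : ∀ j, (f^[j] A.vals).Nonempty := by
    intro j
    induction j with
    | zero => exact A.vals_nonempty
    | succ j ih =>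
      obtain ⟨V, hV⟩ := ih
      have hVX : V ∈ X (j + r) := by simpa [X] using hV
      -- `L[V/x]` terminates because `L[fix x. L/x]` does, in `r` steps. Depth `j + r` is enough for
      -- this and corresponds exactly to the `j`-th iterate, where `V` lives.
      obtain ⟨U', h₁, h₂⟩ := Repl.simulation hanti hX (by omega : r ≤ j + r)
        ((Repl.refl L).inst (.of_mem hVX)) hr hn
      rw [Function.iterate_succ_apply']
      exact ⟨U', h₂.isNormal hn, V, hV, h₁⟩
  refine Ty.mem_vals_of_forall_repl hanti hX hn fun m => ?_
  obtain ⟨V, hV⟩ := hne (m + (r + 1) - r)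
  have hVA : V ∈ A.vals := hiter (Nat.zero_le _) hV
  -- Simulate the evaluation of `fix x. L` with the whole term replaced by `V`. As `V` is a value,
  -- its counterpart of `U` is `V` itself, and depth `m` is left.
  obtain ⟨U', h₁, h₂⟩ := Repl.simulation hanti hX (by omega : r + 1 ≤ m + (r + 1))
    (.of_mem (X := X (m + (r + 1))) hV) hs hn
  rw [Nat.add_sub_cancel] at h₂
  obtain rfl := h₁.eq_of_isNormal (A.isValue_of_mem_vals hVA).isNormal
  exact ⟨_, hVA, h₂⟩

/-! ### Soundness -/

section Sat

variable {n : ℕ} {θ : Fin n → Tm 0} {Γ Δ : Finset (Typing n)} {M : Tm n} {A : Ty}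

theorem satLeft_insert : SatLeft θ (insert ⟨M, A⟩ Γ) ↔
    M.subst θ ∈ EvalsInto A.vals ∧ SatLeft θ Γ := by
  simp [SatLeft]

theorem satRight_insert : SatRight θ (insert ⟨M, A⟩ Δ) ↔
    M.subst θ ∈ EvalsIntoOrDiverges A.vals ∨ SatRight θ Δ := by
  simp [SatRight]

/-- Semantic use of the freshness condition: the value given to the bound variable does not affect
the context. -/
theorem satLeft_wkSet {V : Tm 0} : SatLeft (extend V θ) (wkSet Γ) ↔ SatLeft θ Γ := by
  simp only [SatLeft, wkSet, Finset.forall_mem_image, Typing.wk, Tm.wk_subst_extend]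

theorem satRight_wkSet {V : Tm 0} : SatRight (extend V θ) (wkSet Δ) ↔ SatRight θ Δ := by
  simp only [SatRight, wkSet, Finset.exists_mem_image, Typing.wk, Tm.wk_subst_extend]

theorem IsValuation.extend (hθ : IsValuation θ) {V : Tm 0} (hV : IsValue V) :
    IsValuation (TwoSided.extend V θ) :=
  Fin.cases hV hθ

end Sat

/-! ### Semantic counterparts of the right rules -/

theorem Ty.mem_evalsIntoOrDiverges_letp {A B C : Ty} {M : Tm 0} {N : Tm 2}
    (hM : M ∈ EvalsIntoOrDiverges (Ty.prod B C).vals)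
    (hN : ∀ V ∈ B.vals, ∀ W ∈ C.vals, N.inst₂ V W ∈ EvalsIntoOrDiverges A.vals) :
    Tm.letp M N ∈ EvalsIntoOrDiverges A.vals := by
  refine mem_evalsIntoOrDiverges.2 fun U hU hn => ?_
  obtain ⟨M', h₁, hn₁, h₂⟩ := (isCtx_letp N).steps_inv hU hn
  obtain ⟨V, hV, W, hW, rfl⟩ := mem_evalsIntoOrDiverges.1 hM M' h₁ hn₁
  exact mem_evalsIntoOrDiverges.1 (hN V hV W hW) U
    (h₂.of_head hn (.letp N (B.isValue_of_mem_vals hV) (C.isValue_of_mem_vals hW))) hn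

theorem Ty.mem_evalsIntoOrDiverges_app {A B : Ty} {M N : Tm 0}
    (hM : M ∈ EvalsIntoOrDiverges (Ty.arr B A).vals) (hN : N ∈ EvalsIntoOrDiverges B.vals) :
    Tm.app M N ∈ EvalsIntoOrDiverges A.vals := by
  refine mem_evalsIntoOrDiverges.2 fun U hU hn => ?_
  obtain ⟨M', h₁, hn₁, h₂⟩ := (isCtx_appL N).steps_inv hU hn
  obtain ⟨L, rfl, hL⟩ := mem_evalsIntoOrDiverges.1 hM M' h₁ hn₁
  obtain ⟨V, h₃, hn₂, h₄⟩ := (isCtx_appR L).steps_inv h₂ hn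
  have hV := mem_evalsIntoOrDiverges.1 hN V h₃ hn₂
  have hV' := B.isValue_of_mem_vals hV
  exact mem_evalsIntoOrDiverges.1 (hL V hV' hV) U (h₄.of_head hn (.beta L hV')) hn

theorem Ty.mem_evalsIntoOrDiverges_pair {A B : Ty} {M N : Tm 0}
    (hM : M ∈ EvalsIntoOrDiverges A.vals) (hN : N ∈ EvalsIntoOrDiverges B.vals) :
    Tm.pair M N ∈ EvalsIntoOrDiverges (Ty.prod A B).vals := by
  refine mem_evalsIntoOrDiverges.2 fun U hU hn => ?_
  obtain ⟨M', h₁, hn₁, h₂, -⟩ := hU.pair_inv hn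
  have hM' := mem_evalsIntoOrDiverges.1 hM M' h₁ hn₁
  obtain ⟨N', h₃, hn₂, rfl⟩ := h₂ (A.isValue_of_mem_vals hM')
  exact ⟨M', hM', N', mem_evalsIntoOrDiverges.1 hN N' h₃ hn₂, rfl⟩

theorem Ty.mem_evalsIntoOrDiverges_ifz {A : Ty} {M N P : Tm 0}
    (hM : M ∈ EvalsIntoOrDiverges Ty.nat.vals) (hN : N ∈ EvalsIntoOrDiverges A.vals)
    (hP : P ∈ EvalsIntoOrDiverges A.vals) :
    Tm.ifz M N P ∈ EvalsIntoOrDiverges A.vals := by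
  refine mem_evalsIntoOrDiverges.2 fun U hU hn => ?_
  obtain ⟨M', h₁, hn₁, h₂⟩ := (isCtx_ifz N P).steps_inv hU hn
  obtain ⟨k, rfl⟩ := mem_evalsIntoOrDiverges.1 hM M' h₁ hn₁
  cases k with
  | zero => exact mem_evalsIntoOrDiverges.1 hN U (h₂.of_head hn (.ifZ N P)) hn
  | succ k => exact mem_evalsIntoOrDiverges.1 hP U (h₂.of_head hn (.ifS k N P)) hn

theorem Ty.mem_evalsIntoOrDiverges_succ {M : Tm 0} (hM : M ∈ EvalsIntoOrDiverges Ty.nat.vals) :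
    Tm.succ M ∈ EvalsIntoOrDiverges Ty.nat.vals := by
  refine mem_evalsIntoOrDiverges.2 fun U hU hn => ?_
  obtain ⟨M', h₁, hn₁, rfl⟩ := hU.succ_inv hn
  obtain ⟨k, rfl⟩ := mem_evalsIntoOrDiverges.1 hM M' h₁ hn₁
  exact ⟨k + 1, rfl⟩

theorem Ty.mem_evalsIntoOrDiverges_pred {M : Tm 0} (hM : M ∈ EvalsIntoOrDiverges Ty.nat.vals) :
    Tm.pred M ∈ EvalsIntoOrDiverges Ty.nat.vals := by
  refine mem_evalsIntoOrDiverges.2 fun U hU hn => ?_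
  obtain ⟨M', h₁, hn₁, h₂⟩ := isCtx_pred.steps_inv hU hn
  obtain ⟨k, rfl⟩ := mem_evalsIntoOrDiverges.1 hM M' h₁ hn₁
  cases k with
  | zero =>
    exact ⟨0, (h₂.of_head hn .predZ).eq_of_isNormal (isNormal_numeral 0)⟩
  | succ k => exact ⟨k, (h₂.of_head hn (.predS k)).eq_of_isNormal (isNormal_numeral k)⟩

theorem mem_evalsInto_nat {M : Tm 0} : M ∈ EvalsInto Ty.nat.vals ↔ ∃ k, Steps M (numeral k) := by
  rw [mem_evalsInto]
  constructor
  · rintro ⟨_, ⟨k, rfl⟩, h⟩; exact ⟨k, h⟩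
  · rintro ⟨k, h⟩; exact ⟨_, ⟨k, rfl⟩, h⟩

/-- Induction on derivations. Where several premises or a binder are involved, one usually assumes
that `Δ` fails under `θ`, so that each premise must yield its principal formula. -/
theorem Provable.isTrue {n : ℕ} {Γ Δ : Finset (Typing n)} (h : Provable Γ Δ) : IsTrue Γ Δ := by
  induction h with
  | id Γ Δ x A =>
    intro θ hθ hΓ
    exact satRight_insert.2 (.inl (.inl (satLeft_insert.1 hΓ).1))
  | dis hd _ ih =>
    intro θ hθ hΓ
    obtain ⟨hM, hΓ⟩ := satLeft_insert.1 hΓ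
    refine (satRight_insert.1 (ih θ hθ hΓ)).resolve_left fun hB => ?_
    obtain ⟨V, hV, hs⟩ := mem_evalsInto.1 hM
    exact hd.not_mem hV
      (mem_evalsIntoOrDiverges.1 hB V hs (Ty.isValue_of_mem_vals hV).isNormal)
  | zeroR => exact fun θ _ _ =>
      satRight_insert.2 (.inl (mem_evalsIntoOrDiverges_of_mem (A := .nat) ⟨0, rfl⟩))
  | succR _ ih => exact fun θ hθ hΓ =>
      satRight_insert.2 ((satRight_insert.1 (ih θ hθ hΓ)).imp_left Ty.mem_evalsIntoOrDiverges_succ)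
  | predR _ ih => exact fun θ hθ hΓ =>
      satRight_insert.2 ((satRight_insert.1 (ih θ hθ hΓ)).imp_left Ty.mem_evalsIntoOrDiverges_pred)
  | letR _ _ ih₁ ih₂ =>
    intro θ hθ hΓ
    refine satRight_insert.2 (or_iff_not_imp_right.2 fun hΔ => ?_)
    refine Ty.mem_evalsIntoOrDiverges_letp ((satRight_insert.1 (ih₁ θ hθ hΓ)).resolve_right hΔ)
      fun V hV W hW => ?_
    rw [Tm.inst₂_subst_liftSub]
    have := ih₂ (extend V (extend W θ))
      ((hθ.extend (Ty.isValue_of_mem_vals hW)).extend (Ty.isValue_of_mem_vals hV))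
      (satLeft_insert.2 ⟨mem_evalsInto.2 ⟨V, hV, .refl⟩,
        satLeft_insert.2 ⟨mem_evalsInto.2 ⟨W, hW, .refl⟩, satLeft_wkSet.2 (satLeft_wkSet.2 hΓ)⟩⟩)
    rw [satRight_insert, satRight_wkSet, satRight_wkSet] at this
    exact this.resolve_right hΔ
  | appR _ _ ih₁ ih₂ =>
    intro θ hθ hΓ
    refine satRight_insert.2 (or_iff_not_imp_right.2 fun hΔ => ?_)
    exact Ty.mem_evalsIntoOrDiverges_app ((satRight_insert.1 (ih₁ θ hθ hΓ)).resolve_right hΔ)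
      ((satRight_insert.1 (ih₂ θ hθ hΓ)).resolve_right hΔ)
  | pairR _ _ ih₁ ih₂ =>
    intro θ hθ hΓ
    refine satRight_insert.2 (or_iff_not_imp_right.2 fun hΔ => ?_)
    exact Ty.mem_evalsIntoOrDiverges_pair ((satRight_insert.1 (ih₁ θ hθ hΓ)).resolve_right hΔ)
      ((satRight_insert.1 (ih₂ θ hθ hΓ)).resolve_right hΔ)
  | absR _ ih =>
    intro θ hθ hΓ
    refine satRight_insert.2 (or_iff_not_imp_right.2 fun hΔ => ?_)
    refine mem_evalsIntoOrDiverges_of_mem ⟨_, rfl, fun V hV hVB => ?_⟩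
    rw [Tm.inst_subst_liftSub]
    have := ih (extend V θ) (hθ.extend hV)
      (satLeft_insert.2 ⟨mem_evalsInto.2 ⟨V, hVB, .refl⟩, satLeft_wkSet.2 hΓ⟩)
    rw [satRight_insert, satRight_wkSet] at this
    exact this.resolve_right hΔ
  | @abnR _ Γ Δ M B F _ ih =>
    intro θ hθ hΓ
    refine satRight_insert.2 (or_iff_not_imp_right.2 fun hΔ => ?_)
    refine mem_evalsIntoOrDiverges_of_mem ⟨_, rfl, fun V hV hVF => ?_⟩
    rw [Tm.inst_subst_liftSub, ← FTy.vals_toTy] at hVF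
    have := ih (extend V θ) (hθ.extend hV) (satLeft_insert.2 ⟨hVF, satLeft_wkSet.2 hΓ⟩)
    rw [satRight_insert, satRight_wkSet] at this
    -- The principal formula on the right concerns a variable, whose instance is a value and cannot
    -- diverge.
    exact hV.mem_evalsIntoOrDiverges_iff.1 (this.resolve_right hΔ)
  | fixR _ ih =>
    intro θ hθ hΓ
    refine satRight_insert.2 (or_iff_not_imp_right.2 fun hΔ => ?_)
    refine fix_mem_evalsIntoOrDiverges fun V hV => ?_
    rw [Tm.inst_subst_liftSub]
    have := ih (extend V θ) (hθ.extend (Ty.isValue_of_mem_vals hV))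
      (satLeft_insert.2 ⟨mem_evalsInto.2 ⟨V, hV, .refl⟩, satLeft_wkSet.2 hΓ⟩)
    rw [satRight_insert, satRight_wkSet] at this
    exact this.resolve_right hΔ
  | ifzR _ _ _ ih₁ ih₂ ih₃ =>
    intro θ hθ hΓ
    refine satRight_insert.2 (or_iff_not_imp_right.2 fun hΔ => ?_)
    exact Ty.mem_evalsIntoOrDiverges_ifz ((satRight_insert.1 (ih₁ θ hθ hΓ)).resolve_right hΔ)
      ((satRight_insert.1 (ih₂ θ hθ hΓ)).resolve_right hΔ)
      ((satRight_insert.1 (ih₃ θ hθ hΓ)).resolve_right hΔ)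
  | succL _ ih | okSL _ ih =>
    intro θ hθ hΓ
    obtain ⟨hM, hΓ⟩ := satLeft_insert.1 hΓ
    obtain ⟨V, hV, hs⟩ := mem_evalsInto.1 hM
    exact ih θ hθ (satLeft_insert.2
      ⟨mem_evalsInto_nat.2 (hs.succ_value_inv (Ty.isValue_of_mem_vals hV)), hΓ⟩)
  | predL _ ih | okPL _ ih =>
    intro θ hθ hΓ
    obtain ⟨hM, hΓ⟩ := satLeft_insert.1 hΓ
    obtain ⟨V, hV, hs⟩ := mem_evalsInto.1 hM
    exact ih θ hθ (satLeft_insert.2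
      ⟨mem_evalsInto_nat.2 (hs.pred_value_inv (Ty.isValue_of_mem_vals hV)), hΓ⟩)
  | @appL _ Γ Δ M N B F _ _ ih₁ ih₂ =>
    intro θ hθ hΓ
    obtain ⟨hM, hΓ⟩ := satLeft_insert.1 hΓ
    by_contra hΔ
    obtain ⟨U, hU, hs⟩ := mem_evalsInto.1 hM
    obtain ⟨L, V, h₁, h₂, hV, h₃⟩ := hs.app_value_inv (Ty.isValue_of_mem_vals hU)
    -- Since the application evaluates, its function part does not diverge; the abstraction it
    -- reaches must therefore belong to the necessity arrow, which forces the argument into `B`.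
    obtain ⟨_, e, hL⟩ := mem_evalsIntoOrDiverges.1
      ((satRight_insert.1 (ih₁ θ hθ hΓ)).resolve_right hΔ) _ h₁ (IsValue.lam L).isNormal
    cases e
    rw [← FTy.vals_toTy] at hL
    exact hΔ (ih₂ θ hθ (satLeft_insert.2
      ⟨mem_evalsInto.2 ⟨V, hL V hV (mem_evalsInto.2 ⟨U, hU, h₃⟩), h₂⟩, hΓ⟩))
  | pairL1 _ ih =>
    intro θ hθ hΓ
    obtain ⟨hM, hΓ⟩ := satLeft_insert.1 hΓ
    obtain ⟨_, ⟨V, hV, W, hW, rfl⟩, hs⟩ := mem_evalsInto.1 hM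
    obtain ⟨_, _, h₁, -, h₂, -, e⟩ := hs.pair_value_inv
      (.pair (Ty.isValue_of_mem_vals hV) (Ty.isValue_of_mem_vals hW))
    cases e
    exact ih θ hθ (satLeft_insert.2 ⟨mem_evalsInto.2 ⟨V, hV, h₁⟩, hΓ⟩)
  | pairL2 _ ih =>
    intro θ hθ hΓ
    obtain ⟨hM, hΓ⟩ := satLeft_insert.1 hΓ
    obtain ⟨_, ⟨V, hV, W, hW, rfl⟩, hs⟩ := mem_evalsInto.1 hM
    obtain ⟨_, _, h₁, -, h₂, -, e⟩ := hs.pair_value_inv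
      (.pair (Ty.isValue_of_mem_vals hV) (Ty.isValue_of_mem_vals hW))
    cases e
    exact ih θ hθ (satLeft_insert.2 ⟨mem_evalsInto.2 ⟨W, hW, h₂⟩, hΓ⟩)
  | letL1 _ ih =>
    intro θ hθ hΓ
    obtain ⟨hM, hΓ⟩ := satLeft_insert.1 hΓ
    obtain ⟨U, hU, hs⟩ := mem_evalsInto.1 hM
    obtain ⟨V, W, -, hV, hW, h⟩ := hs.letp_value_inv (Ty.isValue_of_mem_vals hU)
    rw [Tm.inst₂_subst_liftSub] at h
    have := ih (extend V (extend W θ)) ((hθ.extend hW).extend hV)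
      (satLeft_insert.2 ⟨mem_evalsInto.2 ⟨U, hU, h⟩, satLeft_wkSet.2 (satLeft_wkSet.2 hΓ)⟩)
    rwa [satRight_wkSet, satRight_wkSet] at this
  | letL2 _ _ _ ih₁ ih₂ ih₃ =>
    intro θ hθ hΓ
    obtain ⟨hM, hΓ⟩ := satLeft_insert.1 hΓ
    by_contra hΔ
    obtain ⟨U, hU, hs⟩ := mem_evalsInto.1 hM
    obtain ⟨V, W, hVW, hV, hW, h⟩ := hs.letp_value_inv (Ty.isValue_of_mem_vals hU)
    rw [Tm.inst₂_subst_liftSub] at h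
    have hθ' := (hθ.extend hW).extend hV
    have hΓ' := satLeft_insert.2 ⟨mem_evalsInto.2 ⟨U, hU, h⟩, satLeft_wkSet.2 (satLeft_wkSet.2 hΓ)⟩
    have h₁ := ih₂ _ hθ' hΓ'
    have h₂ := ih₃ _ hθ' hΓ'
    rw [satRight_insert, satRight_wkSet, satRight_wkSet] at h₁ h₂
    exact hΔ (ih₁ θ hθ (satLeft_insert.2 ⟨mem_evalsInto.2 ⟨_,
      ⟨V, hV.mem_evalsIntoOrDiverges_iff.1 (h₁.resolve_right hΔ),
        W, hW.mem_evalsIntoOrDiverges_iff.1 (h₂.resolve_right hΔ), rfl⟩, hVW⟩, hΓ⟩))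
  | ifzL1 _ ih =>
    intro θ hθ hΓ
    obtain ⟨hM, hΓ⟩ := satLeft_insert.1 hΓ
    obtain ⟨U, hU, hs⟩ := mem_evalsInto.1 hM
    obtain ⟨k, h, -⟩ := hs.ifz_value_inv (Ty.isValue_of_mem_vals hU)
    exact ih θ hθ (satLeft_insert.2 ⟨mem_evalsInto_nat.2 ⟨k, h⟩, hΓ⟩)
  | ifzL2 _ _ ih₁ ih₂ =>
    intro θ hθ hΓ
    obtain ⟨hM, hΓ⟩ := satLeft_insert.1 hΓ
    obtain ⟨U, hU, hs⟩ := mem_evalsInto.1 hM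
    obtain ⟨k, -, h | h⟩ := hs.ifz_value_inv (Ty.isValue_of_mem_vals hU)
    · exact ih₁ θ hθ (satLeft_insert.2 ⟨mem_evalsInto.2 ⟨U, hU, h⟩, hΓ⟩)
    · exact ih₂ θ hθ (satLeft_insert.2 ⟨mem_evalsInto.2 ⟨U, hU, h⟩, hΓ⟩)
  | okVarR Γ Δ x => exact fun θ hθ _ =>
      satRight_insert.2 (.inl (mem_evalsIntoOrDiverges_of_mem (A := .ok) (hθ x)))
  | okL _ ih =>
    intro θ hθ hΓ
    obtain ⟨hM, hΓ⟩ := satLeft_insert.1 hΓ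
    obtain ⟨U, hU, hs⟩ := mem_evalsInto.1 hM
    exact ih θ hθ (satLeft_insert.2
      ⟨mem_evalsInto.2 ⟨U, Ty.isValue_of_mem_vals hU, hs⟩, hΓ⟩)
  | okR _ ih =>
    intro θ hθ hΓ
    refine satRight_insert.2 ((satRight_insert.1 (ih θ hθ hΓ)).imp_left fun h => ?_)
    exact mem_evalsIntoOrDiverges.2 fun U hU hn =>
      Ty.isValue_of_mem_vals (mem_evalsIntoOrDiverges.1 h U hU hn)
  | okApL1 _ ih =>
    intro θ hθ hΓ
    obtain ⟨hM, hΓ⟩ := satLeft_insert.1 hΓ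
    obtain ⟨U, hU, hs⟩ := mem_evalsInto.1 hM
    obtain ⟨L, V, h, -⟩ := hs.app_value_inv hU
    exact ih θ hθ (satLeft_insert.2
      -- Every closed abstraction is in `Ok` only to `F`, whatever `F` is, because all closed values
      -- are `Ok`.
      ⟨mem_evalsInto.2 ⟨_, ⟨L, rfl, fun V hV _ => hV⟩, h⟩, hΓ⟩)
  | okApL2 _ ih =>
    intro θ hθ hΓ
    obtain ⟨hM, hΓ⟩ := satLeft_insert.1 hΓ
    obtain ⟨U, hU, hs⟩ := mem_evalsInto.1 hM
    obtain ⟨L, V, -, h, hV, -⟩ := hs.app_value_inv hU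
    exact ih θ hθ (satLeft_insert.2 ⟨mem_evalsInto.2 ⟨V, hV, h⟩, hΓ⟩)
  | okPrL1 _ ih =>
    intro θ hθ hΓ
    obtain ⟨hM, hΓ⟩ := satLeft_insert.1 hΓ
    obtain ⟨U, hU, hs⟩ := mem_evalsInto.1 hM
    obtain ⟨V, W, h, hV, -⟩ := hs.pair_value_inv hU
    exact ih θ hθ (satLeft_insert.2 ⟨mem_evalsInto.2 ⟨V, hV, h⟩, hΓ⟩)
  | okPrL2 _ ih =>
    intro θ hθ hΓ
    obtain ⟨hM, hΓ⟩ := satLeft_insert.1 hΓ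
    obtain ⟨U, hU, hs⟩ := mem_evalsInto.1 hM
    obtain ⟨V, W, -, -, h, hW, -⟩ := hs.pair_value_inv hU
    exact ih θ hθ (satLeft_insert.2 ⟨mem_evalsInto.2 ⟨W, hW, h⟩, hΓ⟩)

/-! ### Consequences for closed terms, under the empty valuation -/

theorem WellTyped.not_goesWrong {M : Tm 0} (h : WellTyped M) : ¬ GoesWrong M := by
  rintro ⟨U, hU, hn, hv⟩
  obtain ⟨φ, hφ, hM⟩ := h.isTrue Tm.var (fun x => x.elim0) (by simp [SatLeft])
  rw [Finset.mem_singleton] at hφ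
  subst hφ
  rw [Tm.subst_var] at hM
  exact hv (mem_evalsIntoOrDiverges.1 hM U hU hn)

theorem IllTyped.not_evaluates {M : Tm 0} (h : IllTyped M) : ¬ Evaluates M := by
  rintro ⟨V, hV⟩
  obtain ⟨φ, hφ, -⟩ := h.isTrue Tm.var (fun x => x.elim0) (by
    intro φ hφ
    rw [Finset.mem_singleton] at hφ
    subst hφ
    rw [Tm.subst_var]
    exact ⟨V, hV, hV.2⟩)
  simp at hφ

end TwoSided

theorem mainTheorem1 :
    (∀ (n : ℕ) (Γ Δ : Finset (TwoSided.Typing n)),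
      TwoSided.Provable Γ Δ → TwoSided.IsTrue Γ Δ) ∧
    (∀ M : TwoSided.Tm 0, TwoSided.WellTyped M → ¬ TwoSided.GoesWrong M) ∧
    (∀ M : TwoSided.Tm 0, TwoSided.IllTyped M → ¬ TwoSided.Evaluates M) :=
  ⟨fun _ _ _ h => h.isTrue, fun _ h => h.not_goesWrong, fun _ h => h.not_evaluates⟩
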